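/- For $\varepsilon>0$ let $\Pi_\varepsilon=\{|\operatorname{Im} z|<\varepsilon\}/\mathbb Z\subset\mathbb C/\mathbb Z$, and let $\mathcal D_\varepsilon$ be the space of bounded analytic maps $\Pi_\varepsilon\to\mathbb C/\mathbb Z$ that extend continuously to the closure of $\Pi_\varepsilon$, with the sup-distance; it is modelled, through $g\mapsto f+g \bmod \mathbb Z$, on the complex Banach space of bounded analytic functions $g:\Pi_\varepsilon\to\mathbb C$ that extend continuously to the closure. Let $R_\alpha(z)=z+\alpha \bmod \mathbb Z$. For $K\in\mathbb N$ let $\mathcal{BT}_K$ be the set of irrational $\alpha=[a_0,a_1,a_2,\ldots]\in(0,1)$ whose continued fraction coefficients satisfy $a_i\le K$ for all $i$. A map $f\in\mathcal D_\varepsilon$ is called analytically conjugate to $R_\alpha$ on $\Pi_{\varepsilon/2}$ if there is an injective analytic map $\xi:\Pi_{\varepsilon/2}\to\Pi_\varepsilon$ with $f\circ\xi=\xi\circ R_\alpha$ on $\Pi_{\varepsilon/2}$. **Theorem 2.** Let $K\in\mathbb N$ and $\varepsilon>0$. There exists $\kappa=\kappa(K,\varepsilon)>0$ such that for every $\alpha\in\mathcal{BT}_K$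 the set of maps $f\in\mathcal D_\varepsilon$ that are analytically conjugate to $R_\alpha$ on $\Pi_{\varepsilon/2}$ and whose distance to $R_\alpha$ is less than $\kappa$ contains $R_\alpha$ and is an embedded complex-analytic submanifold of $\mathcal D_\varepsilon$ of codimension $1$. -/

import Mathlib

open scoped BoundedContinuousFunction Topology

noncomputable section

/-! ### Irrational numbers of type bounded by `K` -/

/-- The Gauss map `x ↦ {1/x}`. -/
def gaussMap (x : ℝ) : ℝ := Int.fract (1 / x)

/-- The irrational numbers in `(0,1)` all of whose continued fraction coefficients
`a_i = [1/α_i]`, where `α_0 = α` and `α_{i+1} = {1/α_i}`, are at most `K`. -/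
def BoundedType (K : ℕ) : Set ℝ :=
  {α | Irrational α ∧ α ∈ Set.Ioo (0 : ℝ) 1 ∧ ∀ i : ℕ, ⌊1 / (gaussMap^[i] α)⌋ ≤ (K : ℤ)}

/-! ### The cylinder `ℂ/ℤ` and its strips -/

/-- The cylinder `ℂ/ℤ`, with the quotient norm (the distance of a representative to `ℤ`). -/
abbrev Cyl : Type := ℂ ⧸ AddSubgroup.zmultiples (1 : ℂ)

/-- The imaginary part of a point of the cylinder. -/
def Cyl.im : Cyl →+ ℝ :=
  QuotientAddGroup.lift (AddSubgroup.zmultiples (1 : ℂ)) Complex.imAddGroupHom (by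
    intro x hx
    obtain ⟨n, rfl⟩ := AddSubgroup.mem_zmultiples_iff.1 hx
    simp [AddMonoidHom.mem_ker])

@[simp] theorem Cyl.im_coe (z : ℂ) : Cyl.im (z : Cyl) = z.im := rfl

/-- The open strip `Π_ε = {|Im z| < ε}/ℤ`. -/
def openStrip (ε : ℝ) : Set Cyl := {p | |Cyl.im p| < ε}

/-- The closed strip `{|Im z| ≤ ε}/ℤ`, which is the closure of `Π_ε` when `ε > 0`. -/
def closedStrip (ε : ℝ) : Set Cyl := {p | |Cyl.im p| ≤ ε}

/-- A map from a subset of the cylinder to the cylinder is analytic on `Π_δ` if near every point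
of `Π_δ` it is induced by an analytic function of one complex variable. -/
def IsAnalyticOnStrip (δ : ℝ) {s : Set Cyl} (f : s → Cyl) : Prop :=
  ∀ z : ℂ, (z : Cyl) ∈ openStrip δ → ∃ F : ℂ → ℂ, AnalyticAt ℂ F z ∧
    ∀ᶠ w : ℂ in 𝓝 z, ∀ hw : (w : Cyl) ∈ s, f ⟨w, hw⟩ = (F w : Cyl)

/-- A complex valued function on a subset of the cylinder is analytic on `Π_δ` if it is so in the
coordinate of `ℂ`. -/
def IsAnalyticFunOnStrip (δ : ℝ) {s : Set Cyl} (g : s → ℂ) : Prop :=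
  ∀ z : ℂ, (z : Cyl) ∈ openStrip δ → ∃ F : ℂ → ℂ, AnalyticAt ℂ F z ∧
    ∀ᶠ w : ℂ in 𝓝 z, ∀ hw : (w : Cyl) ∈ s, g ⟨w, hw⟩ = F w

/-! ### The space of maps and its model Banach space -/

/-- The Banach space of bounded analytic functions `Π_ε → ℂ` which extend continuously to the
closed strip, with the sup-norm. -/
def StripFun (ε : ℝ) : Submodule ℂ (closedStrip ε →ᵇ ℂ) where
  carrier := {g | IsAnalyticFunOnStrip ε g}
  zero_mem' := fun z _ => ⟨fun _ => 0, analyticAt_const, by simp⟩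
  add_mem' := by
    intro a b ha hb z hz
    obtain ⟨F, hF, hF'⟩ := ha z hz
    obtain ⟨G, hG, hG'⟩ := hb z hz
    refine ⟨fun w => F w + G w, hF.add hG, ?_⟩
    filter_upwards [hF', hG'] with w h1 h2 hw
    simp [h1 hw, h2 hw]
  smul_mem' := by
    intro c a ha z hz
    obtain ⟨F, hF, hF'⟩ := ha z hz
    refine ⟨fun w => c * F w, analyticAt_const.mul hF, ?_⟩
    filter_upwards [hF'] with w h1 hw
    simp [h1 hw]

/-- The space `𝒟_ε` of bounded analytic maps `Π_ε → ℂ/ℤ` which extend continuously to the closed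
strip, with the sup-distance (inherited from the bounded continuous maps). -/
def StripMap (ε : ℝ) : Type := {f : closedStrip ε →ᵇ Cyl // IsAnalyticOnStrip ε f}

instance (ε : ℝ) : PseudoMetricSpace (StripMap ε) :=
  inferInstanceAs (PseudoMetricSpace {f : closedStrip ε →ᵇ Cyl // IsAnalyticOnStrip ε f})

instance (ε : ℝ) : CoeFun (StripMap ε) (fun _ => closedStrip ε → Cyl) := ⟨fun f => f.1⟩

theorem lipschitzWith_cyl_mk : LipschitzWith 1 (fun z : ℂ => (z : Cyl)) :=
  LipschitzWith.of_dist_le_mul fun x y => by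
    rw [dist_eq_norm, dist_eq_norm, ← QuotientAddGroup.mk_sub, NNReal.coe_one, one_mul]
    exact QuotientAddGroup.norm_mk_le_norm

/-- The affine structure of `𝒟_ε`: a function `g : Π_ε → ℂ` translates a map `f` to the map
`z ↦ f z + g z mod ℤ`. -/
instance (ε : ℝ) : VAdd (StripFun ε) (StripMap ε) where
  vadd g f := ⟨BoundedContinuousFunction.comp _ lipschitzWith_cyl_mk g.1 + f.1, by
    intro z hz
    obtain ⟨G, hG, hG'⟩ := g.2 z hz
    obtain ⟨F, hF, hF'⟩ := f.2 z hz
    refine ⟨fun w => G w + F w, hG.add hF, ?_⟩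
    filter_upwards [hF', hG'] with w h1 h2 hw
    simp [h1 hw, h2 hw]⟩

theorem StripMap.vadd_apply {ε : ℝ} (g : StripFun ε) (f : StripMap ε) (p : closedStrip ε) :
    (g +ᵥ f) p = ((g.1 p : ℂ) : Cyl) + f p := rfl

theorem norm_le_of_mem_closedStrip {ε : ℝ} {p : Cyl} (hp : p ∈ closedStrip ε) :
    ‖p‖ ≤ 1 + ε := by
  obtain ⟨z, rfl⟩ := QuotientAddGroup.mk_surjective p
  have h : ((z - (⌊z.re⌋ : ℂ) : ℂ) : Cyl) = (z : Cyl) := by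
    rw [QuotientAddGroup.eq]
    exact AddSubgroup.mem_zmultiples_iff.2 ⟨⌊z.re⌋, by simp⟩
  rw [← h]
  refine QuotientAddGroup.norm_mk_le_norm.trans ((Complex.norm_le_abs_re_add_abs_im _).trans ?_)
  have h1 : |z.im| ≤ ε := hp
  have h2 := Int.fract_nonneg z.re
  have h3 := (Int.fract_lt_one z.re).le
  have h4 : (z - (⌊z.re⌋ : ℂ)).re = Int.fract z.re := by
    simp only [Complex.sub_re, Complex.intCast_re, Int.self_sub_floor]
  have h5 : (z - (⌊z.re⌋ : ℂ)).im = z.im := by simp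
  rw [h4, h5, abs_of_nonneg h2]
  linarith

/-- The rotation `R_α : z ↦ z + α mod ℤ`, as an element of `𝒟_ε`. -/
def cylRotation (ε α : ℝ) : StripMap ε :=
  ⟨BoundedContinuousFunction.ofNormedAddCommGroup
      (fun p : closedStrip ε => (p : Cyl)) continuous_subtype_val (1 + ε)
      (fun p => norm_le_of_mem_closedStrip p.2) +
    BoundedContinuousFunction.const _ (((α : ℂ) : Cyl)), by
    intro z _
    exact ⟨fun w => w + α, analyticAt_id.add analyticAt_const, by simp⟩⟩

theorem cylRotation_apply {ε α : ℝ} (p : closedStrip ε) :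
    cylRotation ε α p = (p : Cyl) + ((α : ℂ) : Cyl) := rfl

/-! ### Conjugacy to a rotation -/

/-- The rotation of the open strip `Π_δ` by `α`. -/
def rotateStrip {δ : ℝ} (α : ℝ) (p : openStrip δ) : openStrip δ :=
  ⟨(p : Cyl) + ((α : ℂ) : Cyl), by
    have h : |Cyl.im (p : Cyl)| < δ := p.2
    simpa [openStrip] using h⟩

theorem openStrip_subset_closedStrip (ε : ℝ) : openStrip ε ⊆ closedStrip ε :=
  fun p hp => le_of_lt (show |Cyl.im p| < ε from hp)

/-- `f ∈ 𝒟_ε` is analytically conjugate to `R_α` on `Π_δ`: there is a conformal (injective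
analytic) map `ξ : Π_δ → Π_ε` with `f ∘ ξ = ξ ∘ R_α` on `Π_δ`. -/
def IsConjToRotation {ε : ℝ} (f : StripMap ε) (α δ : ℝ) : Prop :=
  ∃ ξ : openStrip δ → openStrip ε, Function.Injective ξ ∧
    IsAnalyticOnStrip δ (fun p => (ξ p : Cyl)) ∧
    ∀ p, f (Set.inclusion (openStrip_subset_closedStrip ε) (ξ p)) = ξ (rotateStrip α p)

/-! ### Embedded analytic submanifolds -/

/-- A subset `S` of a complex normed space `E` is, near its point `x`, an embedded analytic
submanifold of codimension `n`: some biholomorphic chart `Φ` of `E` around `x` maps `S` onto the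
part of a closed linear subspace of codimension `n` that lies in the target of the chart. -/
def IsAnalyticSubmanifoldAt {E : Type*} [NormedAddCommGroup E] [NormedSpace ℂ E] (n : ℕ)
    (S : Set E) (x : E) : Prop :=
  ∃ (V : Submodule ℂ E) (Φ : OpenPartialHomeomorph E E),
    IsClosed (V : Set E) ∧ Module.rank ℂ (E ⧸ V) = n ∧ x ∈ Φ.source ∧
    AnalyticOnNhd ℂ Φ Φ.source ∧ AnalyticOnNhd ℂ Φ.symm Φ.target ∧
    Φ '' (S ∩ Φ.source) = (V : Set E) ∩ Φ.target

/-- A subset `S` of `𝒟_ε` is an embedded analytic submanifold of codimension `n` if it is one near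
each of its points `f`, in the affine coordinate `g ↦ f + g` of `𝒟_ε` centred at `f`. This
coordinate is an isometry between the balls of radius `1/2` centred at `0` and at `f`. -/
def IsEmbeddedAnalyticSubmanifold {ε : ℝ} (n : ℕ) (S : Set (StripMap ε)) : Prop :=
  ∀ f ∈ S, IsAnalyticSubmanifoldAt n {g : StripFun ε | g +ᵥ f ∈ S} 0

/-- The maps of `𝒟_ε` at distance less than `κ` from `R_α` which are analytically conjugate to
`R_α` on `Π_{ε/2}`. -/
def conjClass (ε α κ : ℝ) : Set (StripMap ε) :=
  {f | dist f (cylRotation ε α) < κ ∧ IsConjToRotation f α (ε / 2)}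

end

/-!
The maps near the rotation `R_α` are `R_α + g` with `g` small, and the class of `R_α` near `R_α`
turns out to be the graph of an analytic function over the hyperplane of functions `g` with mean
zero.

Existence. For every small `g` there is a constant `c`, depending analytically on `g`, such that
`R_α + g + c` is conjugate to `R_α` by a map `h = id + p` close to the identity
(`exists_conjugacy_family`). Usually this calls for a rapidly converging iteration, because the
operator `u ↦ u ∘ R_α - u` has an unbounded inverse. For `α` of bounded type, however, this inverse
loses just one derivative (`one_le_mul_norm_fourierExp_sub_one`). Differentiating the conjugacy
equation twice gives, for `ψ = log h'`, `(ψ ∘ R_α - ψ)' = (g'' ∘ h) exp (2 ψ - ψ ∘ R_α)`, and the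
inverse of the operator on the left is bounded. In the weighted Wiener algebra, where compositions
are power series, the ordinary analytic implicit function theorem solves the equation up to
constants (`exists_analytic_solution`). Integrating over a period shows that these constants vanish
except for `c` (`exists_const_conjugacy_of_logDeriv`, a trick of Herman). The equation is solved in
the algebra of bounded families indexed by all `α` of type bounded by `K`, so that the estimates do
not depend on `α`.

Uniqueness. If `R_α + g` itself is conjugate to `R_α`, by a map which need not be close to the
identity, then `c = 0` (`const_eq_zero_of_lift`). A lift `H` of the conjugacy has some degree `d`,
which is bounded because the image lies in a strip, and is then equal to one by the Diophantine
property of `α`. The cohomological equation shows that `H` is close to a translation. Some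
horizontal line is therefore mapped near the real axis, where `h⁻¹ ∘ H` is defined and commutes
with `R_α` up to an error proportional to `c`; the mean value of this relation forces `c = 0`
(`const_eq_zero_of_conjugacies`).

Hence `R_α + g` is conjugate to `R_α` if and only if the mean of `g` equals the value of an
analytic function at the oscillating part of `g` (`exists_isConjToRotation_iff`), and such a set is
a hypersurface (`isAnalyticSubmanifoldAt_of_graph`).
-/

noncomputable section

open scoped NNReal ENNReal Topology ContDiff
open Complex (I)

/-! ### The weighted Wiener algebra of a strip -/

/-- The Banach algebra of Fourier series `∑ uₖ exp (2πikz)` with `∑ |uₖ| exp (2πδ|k|) < ∞`, which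
converge absolutely on the closed strip `|Im z| ≤ δ`. It is realized as `ℓ¹` by storing the weighted
coefficients `uₖ exp (2πδ|k|)`, so that norm and completeness are those of `ℓ¹`; the product is the
convolution of Fourier coefficients. -/
def Wiener (_δ : ℝ≥0) : Type := lp (fun _ : ℤ => ℂ) 1

namespace Wiener

variable {δ : ℝ≥0}

instance : NormedAddCommGroup (Wiener δ) :=
  inferInstanceAs (NormedAddCommGroup (lp (fun _ : ℤ => ℂ) 1))
instance : NormedSpace ℂ (Wiener δ) :=
  inferInstanceAs (NormedSpace ℂ (lp (fun _ : ℤ => ℂ) 1))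
instance : CompleteSpace (Wiener δ) :=
  inferInstanceAs (CompleteSpace (lp (fun _ : ℤ => ℂ) 1))

/-- The weight of the `k`-th Fourier mode: the supremum of `z ↦ |exp (2πikz)|` on the strip. -/
def weight (δ : ℝ≥0) (k : ℤ) : ℝ := Real.exp (2 * Real.pi * δ * |(k : ℝ)|)

theorem weight_pos (k : ℤ) : 0 < weight δ k := Real.exp_pos _

@[simp] theorem weight_zero : weight δ 0 = 1 := by simp [weight]

theorem weight_add_le (j k : ℤ) : weight δ (j + k) ≤ weight δ j * weight δ k := by
  rw [weight, weight, weight, ← Real.exp_add, ← mul_add]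
  push_cast
  gcongr
  exact abs_add_le _ _

/-- The `k`-th Fourier coefficient, with the weight of the encoding removed. -/
def coeff (k : ℤ) : Wiener δ →L[ℂ] ℂ :=
  ((weight δ k)⁻¹ : ℂ) • lp.evalCLM ℂ (fun _ : ℤ => ℂ) 1 k

/-- The `k`-th Fourier mode `z ↦ exp (2πikz)`. -/
def mode (k : ℤ) : Wiener δ := (weight δ k : ℂ) • (lp.single 1 k (1 : ℂ) : lp (fun _ : ℤ => ℂ) 1)

theorem hasSum_norm_coeff (u : Wiener δ) :
    HasSum (fun k => ‖coeff k u‖ * weight δ k) ‖u‖ := by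
  have h := lp.hasSum_norm (p := 1) (by simp) (show lp (fun _ : ℤ => ℂ) 1 from u)
  simp only [ENNReal.toReal_one, Real.rpow_one] at h
  refine h.congr_fun fun k => ?_
  have := (weight_pos (δ := δ) k)
  have h2 : coeff k u = ((weight δ k)⁻¹ : ℂ) * (show lp (fun _ : ℤ => ℂ) 1 from u) k := rfl
  rw [h2, norm_mul, norm_inv, Complex.norm_real, Real.norm_of_nonneg this.le]
  field_simp

@[simp] theorem norm_mode (k : ℤ) : ‖(mode k : Wiener δ)‖ = weight δ k := by
  have h : ‖(lp.single 1 k (1 : ℂ) : lp (fun _ : ℤ => ℂ) 1)‖ = 1 := by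
    rw [lp.norm_single (by simp)]; simp
  have h2 : ‖(mode k : Wiener δ)‖ =
    ‖(weight δ k : ℂ) • (lp.single 1 k (1 : ℂ) : lp (fun _ : ℤ => ℂ) 1)‖ := rfl
  rw [h2, norm_smul, h, mul_one, Complex.norm_real, Real.norm_of_nonneg (weight_pos k).le]

theorem hasSum_coeff (u : Wiener δ) : HasSum (fun k => coeff k u • (mode k : Wiener δ)) u := by
  have h := lp.hasSum_single (p := 1) (by simp) (show lp (fun _ : ℤ => ℂ) 1 from u)
  refine h.congr_fun fun k => ?_
  have := (weight_pos (δ := δ) k)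
  have h2 : coeff k u = ((weight δ k)⁻¹ : ℂ) * (show lp (fun _ : ℤ => ℂ) 1 from u) k := rfl
  have h3 : (weight δ k : ℂ) ≠ 0 := by exact_mod_cast this.ne'
  rw [h2, mode]
  refine (smul_smul _ _ _).trans ?_
  rw [mul_right_comm, inv_mul_cancel₀ h3, one_mul]
  refine (lp.single_smul 1 k _ _).symm.trans ?_
  simp

theorem coeff_mode (j k : ℤ) : coeff j (mode k : Wiener δ) = if j = k then 1 else 0 := by
  have h2 : coeff j (mode k : Wiener δ) = ((weight δ j)⁻¹ : ℂ) *
    ((weight δ k : ℂ) * (lp.single 1 k (1 : ℂ) : lp (fun _ : ℤ => ℂ) 1) j) := rfl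
  have h3 : (weight δ k : ℂ) ≠ 0 := by exact_mod_cast (weight_pos k).ne'
  rw [h2, lp.single_apply]
  split_ifs with h
  · subst h; simp [h3]
  · simp [h]

theorem coeff_mode_self (k : ℤ) : coeff k (mode k : Wiener δ) = 1 := by simp [coeff_mode]

theorem norm_coeff_le (k : ℤ) (u : Wiener δ) : ‖coeff k u‖ ≤ ‖u‖ * (weight δ k)⁻¹ := by
  rw [← div_eq_mul_inv, le_div_iff₀ (weight_pos k)]
  exact le_hasSum (hasSum_norm_coeff u) k fun j _ =>
    mul_nonneg (norm_nonneg _) (weight_pos j).le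

section Lift

variable {F : Type*} [NormedAddCommGroup F] [NormedSpace ℂ F]

/-- Continuous linear maps out of the Wiener algebra are determined by the Fourier modes. -/
theorem clm_ext {f g : Wiener δ →L[ℂ] F} (h : ∀ k, f (mode k) = g (mode k)) : f = g := by
  ext u
  refine (f.hasSum (hasSum_coeff u)).unique ?_
  convert! g.hasSum (hasSum_coeff u) using 2 with k
  simp [h]

theorem summable_norm_lift {y : ℤ → F} {C : ℝ} (hy : ∀ k, ‖y k‖ ≤ C * weight δ k) (u : Wiener δ) :
    Summable fun k => ‖coeff k u • y k‖ := by
  refine Summable.of_nonneg_of_le (fun _ => norm_nonneg _) (fun k => ?_)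
    ((hasSum_norm_coeff u).summable.mul_left C)
  rw [norm_smul]
  calc _ ≤ ‖coeff k u‖ * (C * weight δ k) := by gcongr; exact hy k
    _ = _ := by ring

variable [CompleteSpace F]

/-- The continuous linear map out of the Wiener algebra with prescribed values at the Fourier
modes, these being dominated by the weights. -/
def lift (y : ℤ → F) (C : ℝ) (hy : ∀ k, ‖y k‖ ≤ C * weight δ k) : Wiener δ →L[ℂ] F :=
  LinearMap.mkContinuous
    { toFun := fun u => ∑' k, coeff k u • y k
      map_add' := fun u v => by
        rw [← Summable.tsum_add (summable_norm_lift hy u).of_norm (summable_norm_lift hy v).of_norm]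
        simp [add_smul]
      map_smul' := fun c u => by
        rw [RingHom.id_apply, ← (summable_norm_lift hy u).of_norm.tsum_const_smul]
        simp [smul_smul] } C (fun u => by
      refine (norm_tsum_le_tsum_norm (summable_norm_lift hy u)).trans ?_
      rw [← (hasSum_norm_coeff u).tsum_eq, ← tsum_mul_left]
      refine (summable_norm_lift hy u).tsum_le_tsum (fun k => ?_)
        ((hasSum_norm_coeff u).summable.mul_left C)
      rw [norm_smul]
      calc _ ≤ ‖coeff k u‖ * (C * weight δ k) := by gcongr; exact hy k
        _ = _ := by ring)

theorem hasSum_lift {y : ℤ → F} {C : ℝ} (hy : ∀ k, ‖y k‖ ≤ C * weight δ k) (u : Wiener δ) :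
    HasSum (fun k => coeff k u • y k) (lift y C hy u) :=
  (summable_norm_lift hy u).of_norm.hasSum

@[simp] theorem lift_mode {y : ℤ → F} {C : ℝ} (hy : ∀ k, ‖y k‖ ≤ C * weight δ k) (k : ℤ) :
    lift y C hy (mode k) = y k := by
  refine (hasSum_lift hy (mode k)).unique ?_
  convert! hasSum_ite_eq k (y k) using 2 with j
  rw [coeff_mode]
  split_ifs with h
  · simp [h]
  · simp

theorem norm_lift_le {y : ℤ → F} {C : ℝ} (hC : 0 ≤ C) (hy : ∀ k, ‖y k‖ ≤ C * weight δ k) :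
    ‖lift y C hy‖ ≤ C :=
  LinearMap.mkContinuous_norm_le _ hC _

end Lift

theorem norm_mode_add_le (j k : ℤ) :
    ‖(mode (j + k) : Wiener δ)‖ ≤ weight δ j * weight δ k := by
  rw [norm_mode]; exact weight_add_le j k

/-- The bilinear multiplication, determined by `mode j * mode k = mode (j + k)`. -/
def mulCLM : Wiener δ →L[ℂ] Wiener δ →L[ℂ] Wiener δ :=
  lift (fun j => lift (fun k => mode (j + k)) (weight δ j) (norm_mode_add_le j)) 1 fun j => by
    rw [one_mul]; exact norm_lift_le (weight_pos j).le _

instance : Mul (Wiener δ) := ⟨fun u v => mulCLM u v⟩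
instance : One (Wiener δ) := ⟨mode 0⟩

theorem mul_def (u v : Wiener δ) : u * v = mulCLM u v := rfl
theorem one_def : (1 : Wiener δ) = mode 0 := rfl

@[simp] theorem mode_mul_mode (j k : ℤ) : (mode j * mode k : Wiener δ) = mode (j + k) := by
  simp [mul_def, mulCLM]

theorem mul_comm_aux (u v : Wiener δ) : u * v = v * u := by
  have : (mulCLM : Wiener δ →L[ℂ] _) = mulCLM.flip :=
    clm_ext fun j => clm_ext fun k => by
      have := mode_mul_mode (δ := δ) j k
      have h2 := mode_mul_mode (δ := δ) k j
      rw [mul_def] at this h2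
      rw [ContinuousLinearMap.flip_apply, this, h2, add_comm]
  exact congr($this u v)

theorem mul_assoc_aux (u v w : Wiener δ) : u * v * w = u * (v * w) := by
  have h3 : ∀ i j k : ℤ, (mode i * mode j * mode k : Wiener δ) = mode i * (mode j * mode k) := by
    intro i j k; simp [add_assoc]
  have h2 : ∀ (i j : ℤ) (w : Wiener δ), mode i * mode j * w = mode i * (mode j * w) := by
    intro i j w
    have : mulCLM (mulCLM (mode i : Wiener δ) (mode j)) =
      (mulCLM (mode i)).comp (mulCLM (mode j)) := clm_ext fun k => h3 i j k
    exact congr($this w)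
  have h1 : ∀ (i : ℤ) (v w : Wiener δ), mode i * v * w = mode i * (v * w) := by
    intro i v w
    have : (mulCLM.flip w).comp (mulCLM (mode i : Wiener δ)) =
      (mulCLM (mode i)).comp (mulCLM.flip w) := clm_ext fun k => h2 i k w
    exact congr($this v)
  have : (mulCLM.flip w).comp (mulCLM.flip v) = mulCLM.flip (mulCLM v w) :=
    clm_ext fun k => h1 k v w
  exact congr($this u)

theorem one_mul_aux (u : Wiener δ) : 1 * u = u := by
  have : mulCLM (1 : Wiener δ) = ContinuousLinearMap.id ℂ _ :=
    clm_ext fun k => by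
      have := mode_mul_mode (δ := δ) 0 k
      rw [mul_def, zero_add] at this
      exact this
  exact congr($this u)

instance : NormedCommRing (Wiener δ) where
  __ := (inferInstance : NormedAddCommGroup (Wiener δ))
  mul := (· * ·)
  one := 1
  left_distrib u v w := map_add (mulCLM u) v w
  right_distrib u v w := by simp [mul_def]
  zero_mul u := by simp [mul_def]
  mul_zero u := map_zero (mulCLM u)
  mul_assoc := mul_assoc_aux
  mul_comm := mul_comm_aux
  one_mul := one_mul_aux
  mul_one u := (mul_comm_aux u 1).trans (one_mul_aux u)
  norm_mul_le u v := by
    refine (mulCLM u).le_of_opNorm_le ?_ v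
    refine (mulCLM.le_of_opNorm_le (norm_lift_le zero_le_one _) u).trans (one_mul _).le

instance : NormOneClass (Wiener δ) := ⟨by rw [one_def, norm_mode, weight_zero]⟩

instance : NormedAlgebra ℂ (Wiener δ) where
  __ := Algebra.ofModule (R := ℂ) (A := Wiener δ)
    (fun c u v => by simp [mul_def]) (fun c u v => by simp [mul_def])
  norm_smul_le := norm_smul_le

/-- The Fourier multiplier with bounded symbol `m`. -/
def multiplier (m : ℤ → ℂ) (C : ℝ) (hm : ∀ k, ‖m k‖ ≤ C) : Wiener δ →L[ℂ] Wiener δ :=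
  lift (fun k => m k • mode k) C fun k => by
    rw [norm_smul, norm_mode]; exact mul_le_mul_of_nonneg_right (hm k) (weight_pos k).le

theorem norm_multiplier_le {m : ℤ → ℂ} {C : ℝ} (hm : ∀ k, ‖m k‖ ≤ C) :
    ‖(multiplier m C hm : Wiener δ →L[ℂ] Wiener δ)‖ ≤ C :=
  norm_lift_le ((norm_nonneg _).trans (hm 0)) _

theorem coeff_multiplier {m : ℤ → ℂ} {C : ℝ} (hm : ∀ k, ‖m k‖ ≤ C) (k : ℤ) (u : Wiener δ) :
    coeff k (multiplier m C hm u) = m k * coeff k u := by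
  have : (coeff k).comp (multiplier m C hm) = m k • (coeff k : Wiener δ →L[ℂ] ℂ) :=
    clm_ext fun j => by
      simp only [ContinuousLinearMap.comp_apply, multiplier, lift_mode, map_smul, smul_eq_mul,
        smul_apply, coeff_mode]
      split_ifs with h
      · rw [h]
      · simp
  exact congr($this u)

/-- Evaluation at a point of the closed strip of half-width `δ` is a character. -/
def evalHom (z : ℂ) (hz : |z.im| ≤ δ) : Wiener δ →ₐ[ℂ] ℂ :=
  AlgHom.ofLinearMap
    (lift (fun k => Complex.exp (2 * Real.pi * Complex.I * k * z)) 1 (by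
      intro k
      rw [Complex.norm_exp, one_mul, weight, Real.exp_le_exp]
      have : (2 * Real.pi * Complex.I * k * z).re = 2 * Real.pi * (-(k * z.im)) := by
        simp; ring
      rw [this, mul_assoc (2 * Real.pi)]
      gcongr
      calc -(k * z.im) ≤ |(k : ℝ) * z.im| := neg_le_abs _
        _ = |(k : ℝ)| * |z.im| := abs_mul _ _
        _ ≤ |(k : ℝ)| * δ := by gcongr
        _ = _ := mul_comm _ _) : Wiener δ →L[ℂ] ℂ).toLinearMap
    (by simp [one_def])
    (by
      intro u v
      simp only [ContinuousLinearMap.coe_coe]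
      set L : Wiener δ →L[ℂ] ℂ := lift _ _ _
      have h1 : ∀ (j : ℤ) (v : Wiener δ), L (mode j * v) = L (mode j) * L v := by
        intro j v
        have : L.comp (mulCLM (mode j)) = L (mode j) • L := clm_ext fun k => by
          have := mode_mul_mode (δ := δ) j k
          rw [mul_def] at this
          rw [ContinuousLinearMap.comp_apply, this]
          simp only [L, lift_mode, smul_apply, smul_eq_mul]
          rw [← Complex.exp_add]
          congr 1; push_cast; ring
        exact congr($this v)
      have : L.comp (mulCLM.flip v) = L v • L := clm_ext fun k => by
        refine (h1 k v).trans ?_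
        rw [mul_comm]; rfl
      exact (congr($this u)).trans (mul_comm _ _))

theorem hasSum_evalHom {z : ℂ} (hz : |z.im| ≤ δ) (u : Wiener δ) :
    HasSum (fun k => coeff k u * Complex.exp (2 * Real.pi * Complex.I * k * z))
      (evalHom z hz u) := hasSum_lift _ u

theorem norm_evalHom_le {z : ℂ} (hz : |z.im| ≤ δ) (u : Wiener δ) : ‖evalHom z hz u‖ ≤ ‖u‖ := by
  refine (ContinuousLinearMap.le_of_opNorm_le _ (norm_lift_le zero_le_one _) u).trans
    (one_mul _).le

theorem continuous_evalHom {z : ℂ} (hz : |z.im| ≤ δ) : Continuous (evalHom z hz) :=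
  (lift _ _ _ : Wiener δ →L[ℂ] ℂ).continuous

@[simp] theorem evalHom_mode {z : ℂ} (hz : |z.im| ≤ δ) (k : ℤ) :
    evalHom z hz (mode k) = Complex.exp (2 * Real.pi * Complex.I * k * z) := lift_mode _ k

end Wiener

/-! ### Fourier series of analytic functions of period one -/

/-- The Fourier mode `z ↦ exp (2πikz)`. -/
def fourierExp (k : ℤ) (z : ℂ) : ℂ := Complex.exp (2 * Real.pi * I * k * z)

theorem fourierExp_add (k : ℤ) (z w : ℂ) :
    fourierExp k (z + w) = fourierExp k z * fourierExp k w := by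
  rw [fourierExp, fourierExp, fourierExp, ← Complex.exp_add, mul_add]

theorem fourierExp_one (k : ℤ) : fourierExp k 1 = 1 := by
  rw [fourierExp, Complex.exp_eq_one_iff]
  exact ⟨k, by ring⟩

@[simp] theorem fourierExp_zero_left (z : ℂ) : fourierExp 0 z = 1 := by simp [fourierExp]

theorem fourierExp_neg_mul_self (k : ℤ) (z : ℂ) : fourierExp (-k) z * fourierExp k z = 1 := by
  rw [fourierExp, fourierExp, ← Complex.exp_add]
  simp

theorem norm_fourierExp (k : ℤ) (z : ℂ) :
    ‖fourierExp k z‖ = Real.exp (2 * Real.pi * (-(k * z.im))) := by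
  rw [fourierExp, Complex.norm_exp]
  congr 1
  simp; ring

theorem norm_fourierExp_le (k : ℤ) {z : ℂ} {s : ℝ} (hz : |z.im| ≤ s) :
    ‖fourierExp k z‖ ≤ Real.exp (2 * Real.pi * s * |(k : ℝ)|) := by
  rw [norm_fourierExp, mul_assoc (2 * Real.pi)]
  gcongr
  calc -(k * z.im) ≤ |(k : ℝ) * z.im| := neg_le_abs _
    _ = |(k : ℝ)| * |z.im| := abs_mul _ _
    _ ≤ |(k : ℝ)| * s := by gcongr
    _ = _ := mul_comm _ _

theorem hasDerivAt_fourierExp (k : ℤ) (z : ℂ) :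
    HasDerivAt (fourierExp k) (2 * Real.pi * I * k * fourierExp k z) z := by
  have := ((hasDerivAt_id z).const_mul (2 * Real.pi * I * (k : ℂ))).cexp
  refine this.congr_deriv ?_
  simp only [fourierExp, id, mul_one]
  ring

theorem differentiable_fourierExp (k : ℤ) : Differentiable ℂ (fourierExp k) :=
  fun z => (hasDerivAt_fourierExp k z).differentiableAt

theorem summable_int_pow_mul_exp (n : ℕ) {s : ℝ} (hs : 0 < s) :
    Summable fun k : ℤ => |(k : ℝ)| ^ n * Real.exp (-s * |(k : ℝ)|) := by
  have h := Real.summable_pow_mul_exp_neg_nat_mul n hs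
  refine Summable.of_nat_of_neg ?_ ?_
  · simpa using h
  · simpa using h

theorem summable_int_exp {s : ℝ} (hs : 0 < s) :
    Summable fun k : ℤ => Real.exp (-s * |(k : ℝ)|) := by
  simpa using summable_int_pow_mul_exp 0 hs

theorem isOpen_imStrip (σ : ℝ) : IsOpen {z : ℂ | |z.im| < σ} :=
  isOpen_lt (by fun_prop) continuous_const

theorem convex_imStrip (σ : ℝ) : Convex ℝ {z : ℂ | |z.im| < σ} := by
  have : {z : ℂ | |z.im| < σ} = Complex.imLm ⁻¹' (Metric.ball (0 : ℝ) σ) := by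
    ext z; simp
  rw [this]
  exact (convex_ball _ _).linear_preimage _

section Series

variable {b : ℤ → ℂ} {C σ : ℝ}

theorem norm_term_le (hb : ∀ k, ‖b k‖ ≤ C * Real.exp (-(2 * Real.pi * σ * |(k : ℝ)|)))
    {s : ℝ} {z : ℂ} (hz : |z.im| ≤ s) (k : ℤ) :
    ‖b k * fourierExp k z‖ ≤ C * Real.exp (-(2 * Real.pi * (σ - s)) * |(k : ℝ)|) := by
  rw [norm_mul]
  calc _ ≤ C * Real.exp (-(2 * Real.pi * σ * |(k : ℝ)|)) *
        Real.exp (2 * Real.pi * s * |(k : ℝ)|) :=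
        mul_le_mul (hb k) (norm_fourierExp_le k hz) (norm_nonneg _) ((norm_nonneg _).trans (hb k))
    _ = _ := by rw [mul_assoc, ← Real.exp_add]; congr 2; ring

theorem summable_fourierSeries (hb : ∀ k, ‖b k‖ ≤ C * Real.exp (-(2 * Real.pi * σ * |(k : ℝ)|)))
    {z : ℂ} (hz : |z.im| < σ) : Summable fun k => b k * fourierExp k z :=
  Summable.of_norm_bounded
    ((summable_int_exp (s := 2 * Real.pi * (σ - |z.im|))
      (mul_pos (by positivity) (sub_pos.2 hz))).mul_left C) (norm_term_le hb le_rfl)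

theorem hasDerivAt_fourierSeries
    (hb : ∀ k, ‖b k‖ ≤ C * Real.exp (-(2 * Real.pi * σ * |(k : ℝ)|)))
    {z : ℂ} (hz : |z.im| < σ) :
    HasDerivAt (fun z => ∑' k, b k * fourierExp k z)
      (∑' k, 2 * Real.pi * I * k * b k * fourierExp k z) z := by
  obtain ⟨s, hs, hsσ⟩ := exists_between hz
  refine hasDerivAt_tsum_of_isPreconnected (t := {z : ℂ | |z.im| < s}) (y₀ := z) (y := z)
    (g := fun k z => b k * fourierExp k z)
    (g' := fun k z => 2 * Real.pi * I * k * b k * fourierExp k z)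
    (u := fun k : ℤ => 2 * Real.pi * C *
      (|(k : ℝ)| ^ 1 * Real.exp (-(2 * Real.pi * (σ - s)) * |(k : ℝ)|)))
    ((summable_int_pow_mul_exp 1 (mul_pos (by positivity) (sub_pos.2 hsσ))).mul_left _)
    (isOpen_imStrip s) (convex_imStrip s).isPreconnected ?_ ?_ hs
    (summable_fourierSeries hb hz) hs
  · intro k w _
    exact ((hasDerivAt_fourierExp k w).const_mul (b k)).congr_deriv (by ring)
  · intro k w hw
    have h := norm_term_le hb (le_of_lt hw) k
    have : 2 * Real.pi * I * k * b k * fourierExp k w =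
      2 * Real.pi * I * k * (b k * fourierExp k w) := by ring
    rw [this, norm_mul]
    have h2 : ‖2 * Real.pi * I * (k : ℂ)‖ = 2 * Real.pi * |(k : ℝ)| := by
      simp [abs_of_pos Real.pi_pos]
    rw [h2]
    calc _ ≤ 2 * Real.pi * |(k : ℝ)| *
          (C * Real.exp (-(2 * Real.pi * (σ - s)) * |(k : ℝ)|)) := by gcongr
      _ = _ := by ring

/-- The Fourier coefficients of the derivative decay like those of a function on a
slightly narrower strip. -/
theorem exists_bound_deriv_coeff (hb : ∀ k, ‖b k‖ ≤ C * Real.exp (-(2 * Real.pi * σ * |(k : ℝ)|)))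
    {s : ℝ} (hs : s < σ) : ∃ C', ∀ k : ℤ, ‖2 * Real.pi * I * k * b k‖ ≤
      C' * Real.exp (-(2 * Real.pi * s * |(k : ℝ)|)) := by
  refine ⟨C / (σ - s), fun k => ?_⟩
  have h2 : ‖2 * Real.pi * I * (k : ℂ)‖ = 2 * Real.pi * |(k : ℝ)| := by
    simp [abs_of_pos Real.pi_pos]
  have hpos : 0 < σ - s := sub_pos.2 hs
  have hC : 0 ≤ C := by simpa using (norm_nonneg _).trans (hb 0)
  rw [norm_mul, h2]
  have h3 : 2 * Real.pi * (σ - s) * |(k : ℝ)| ≤ Real.exp (2 * Real.pi * (σ - s) * |(k : ℝ)|) :=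
    (by linarith : _ ≤ _ + (1 : ℝ)).trans (Real.add_one_le_exp _)
  calc _ ≤ 2 * Real.pi * |(k : ℝ)| * (C * Real.exp (-(2 * Real.pi * σ * |(k : ℝ)|))) := by
        gcongr; exact hb k
    _ = C / (σ - s) * ((2 * Real.pi * (σ - s) * |(k : ℝ)|) *
        Real.exp (-(2 * Real.pi * σ * |(k : ℝ)|))) := by field_simp
    _ ≤ C / (σ - s) * (Real.exp (2 * Real.pi * (σ - s) * |(k : ℝ)|) *
        Real.exp (-(2 * Real.pi * σ * |(k : ℝ)|))) := by gcongr
    _ = _ := by rw [← Real.exp_add]; congr 2; ring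

end Series

/-- The `k`-th Fourier coefficient of a function of period `1`, computed on the real line. -/
def fourierInt (u : ℂ → ℂ) (k : ℤ) : ℂ := ∫ x in (0 : ℝ)..1, u x * fourierExp (-k) x

section Periodic

variable {u : ℂ → ℂ} {σ : ℝ}

/-- Fourier coefficients of an analytic function can be computed on every horizontal line. -/
theorem fourierInt_eq_shift (hd : DifferentiableOn ℂ u {z : ℂ | |z.im| < σ})
    (hp : ∀ z : ℂ, u (z + 1) = u z) (k : ℤ) {y : ℝ} (hy : |y| < σ) :
    fourierInt u k = ∫ x in (0 : ℝ)..1, u (x + y * I) * fourierExp (-k) (x + y * I) := by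
  have h := Complex.integral_boundary_rect_eq_zero_of_differentiableOn
    (fun z => u z * fourierExp (-k) z) 0 (1 + y * I) (by
      refine (hd.mono ?_).mul (differentiable_fourierExp _).differentiableOn
      intro z hz
      have hz2 : z.im ∈ Set.uIcc 0 y := by simpa using hz.2
      have : |z.im - 0| ≤ |y - 0| := Set.abs_sub_left_of_mem_uIcc hz2
      simp only [sub_zero] at this
      exact this.trans_lt hy)
  have hper : ∀ t : ℝ, u (1 + t * I) * fourierExp (-k) (1 + t * I) =
      u (t * I) * fourierExp (-k) (t * I) := by
    intro t
    rw [add_comm, hp, fourierExp_add, fourierExp_one, mul_one]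
  simp [hper, sub_eq_zero] at h
  simpa [fourierInt] using h

theorem norm_fourierInt_le (hd : DifferentiableOn ℂ u {z : ℂ | |z.im| < σ})
    (hp : ∀ z : ℂ, u (z + 1) = u z) {s B : ℝ} (hs0 : 0 ≤ s) (hs : s < σ)
    (hB : ∀ z : ℂ, |z.im| ≤ s → ‖u z‖ ≤ B) (k : ℤ) :
    ‖fourierInt u k‖ ≤ B * Real.exp (-(2 * Real.pi * s * |(k : ℝ)|)) := by
  have key : ∀ y : ℝ, |y| ≤ s → ‖fourierInt u k‖ ≤ B * Real.exp (2 * Real.pi * (k * y)) := by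
    intro y hy
    rw [fourierInt_eq_shift hd hp k (hy.trans_lt hs)]
    have := intervalIntegral.norm_integral_le_of_norm_le_const (a := 0) (b := 1)
      (f := fun x : ℝ => u (x + y * I) * fourierExp (-k) (x + y * I))
      (C := B * Real.exp (2 * Real.pi * (k * y))) (by
        intro x _
        rw [norm_mul, norm_fourierExp]
        have h1 : ‖u (x + y * I)‖ ≤ B := hB _ (by simpa using hy)
        have h2 : (-(((-k : ℤ) : ℝ) * ((x : ℂ) + y * I).im)) = k * y := by simp
        rw [h2]
        gcongr)
    simpa using this
  rcases le_total 0 (k : ℝ) with hk | hk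
  · refine (key (-s) (by rw [abs_neg, abs_of_nonneg hs0])).trans_eq ?_
    rw [abs_of_nonneg hk]; congr 2; ring
  · refine (key s (by rw [abs_of_nonneg hs0])).trans_eq ?_
    rw [abs_of_nonpos hk]; congr 2; ring

theorem exists_bound_of_periodic (hc : ContinuousOn u {z : ℂ | |z.im| < σ})
    (hp : ∀ z : ℂ, u (z + 1) = u z) {s : ℝ} (hs : s < σ) :
    ∃ B, ∀ z : ℂ, |z.im| ≤ s → ‖u z‖ ≤ B := by
  have hK : IsCompact (Set.Icc (0 : ℝ) 1 ×ℂ Set.Icc (-s) s) := isCompact_Icc.reProdIm isCompact_Icc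
  obtain ⟨B, hB⟩ := hK.exists_bound_of_continuousOn (f := u) (hc.mono fun z hz =>
    (abs_le.2 ⟨hz.2.1, hz.2.2⟩).trans_lt hs)
  have hpi : Function.Periodic u 1 := hp
  refine ⟨B, fun z hz => ?_⟩
  have h1 : u (z - (⌊z.re⌋ : ℤ)) = u z := by
    have := hpi.sub_int_mul_eq (x := z) ⌊z.re⌋
    simpa using this
  rw [← h1]
  apply hB
  constructor
  · simp only [Set.mem_preimage, Complex.sub_re, Complex.intCast_re]
    exact ⟨Int.fract_nonneg z.re, (Int.fract_lt_one z.re).le⟩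
  · simpa using abs_le.1 hz

/-- An analytic function of period `1` on a strip is the sum of its Fourier series. -/
theorem hasSum_fourierInt (hd : DifferentiableOn ℂ u {z : ℂ | |z.im| < σ})
    (hp : ∀ z : ℂ, u (z + 1) = u z) {z : ℂ} (hz : |z.im| < σ) :
    HasSum (fun k => fourierInt u k * fourierExp k z) (u z) := by
  obtain ⟨s, hs, hsσ⟩ := exists_between hz
  obtain ⟨B, hB⟩ := exists_bound_of_periodic hd.continuousOn hp hsσ
  have hb := norm_fourierInt_le hd hp ((abs_nonneg _).trans hs.le) hsσ hB
  have hsum := summable_fourierSeries hb hs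
  have hsum0 := (summable_fourierSeries (σ := s - |z.im|) (C := B) (z := 0)
    (b := fun k => fourierInt u k * fourierExp k (z.im * I)) (by
      intro k
      have h := norm_term_le hb (s := |z.im|) (z := z.im * I) (by simp) k
      refine h.trans_eq ?_
      congr 2; ring) (by simpa using hs))
  -- On the horizontal line through `z`, Fourier's theorem on the circle applies.
  let v : ℝ → ℂ := fun x => u (x + z.im * I)
  have hv : Continuous v := by
    refine hd.continuousOn.comp_continuous (by fun_prop) (fun x => ?_)
    simpa using hz
  have hvp : Function.Periodic v 1 := by
    intro x
    have := hp (x + z.im * I)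
    simp only [v]
    rw [← this]; congr 1; push_cast; ring
  have : Fact ((0 : ℝ) < 1) := ⟨one_pos⟩
  let w : C(AddCircle (1 : ℝ), ℂ) := ⟨hvp.lift, by
    exact continuous_coinduced_dom.2 hv⟩
  have hcoef : ∀ k, fourierCoeff w k = fourierInt u k * fourierExp k (z.im * I) := by
    intro k
    rw [fourierCoeff_eq_intervalIntegral _ _ 0, fourierInt_eq_shift hd hp k hz,
      ← intervalIntegral.integral_mul_const]
    simp only [zero_add, div_one, one_smul, smul_eq_mul]
    refine intervalIntegral.integral_congr fun x _ => ?_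
    have h1 : (w (x : AddCircle (1 : ℝ))) = v x := rfl
    have h2 : fourier (-k) (x : AddCircle (1 : ℝ)) = fourierExp (-k) x := by
      rw [fourier_coe_apply, fourierExp]; simp
    rw [h1, h2, fourierExp_add, mul_assoc, mul_assoc, fourierExp_neg_mul_self, mul_one, mul_comm]
  have := has_pointwise_sum_fourier_series_of_summable (f := w) (by
    refine hsum0.congr fun k => ?_
    rw [hcoef]; simp [fourierExp]) (z.re : AddCircle (1 : ℝ))
  have h1 : w (z.re : AddCircle (1 : ℝ)) = u z := by
    have : w (z.re : AddCircle (1 : ℝ)) = v z.re := rfl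
    rw [this]; simp [v]
  rw [h1] at this
  refine this.congr_fun fun k => ?_
  have h2 : fourier k (z.re : AddCircle (1 : ℝ)) = fourierExp k z.re := by
    rw [fourier_coe_apply, fourierExp]; simp
  rw [hcoef, h2, smul_eq_mul, mul_assoc, ← fourierExp_add, add_comm, Complex.re_add_im]

end Periodic

/-! ### Small divisors of numbers of bounded type -/

section BoundedType

variable {K : ℕ} {α : ℝ}

theorem gaussMap_mem_boundedType (h : α ∈ BoundedType K) : gaussMap α ∈ BoundedType K := by
  obtain ⟨hirr, ⟨h0, h1⟩, hK⟩ := h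
  have hirr' : Irrational (gaussMap α) := by
    have h : Irrational (1 / α) := by rw [one_div]; exact hirr.inv
    exact h.sub_intCast ⌊1 / α⌋
  refine ⟨hirr', ⟨lt_of_le_of_ne (Int.fract_nonneg _) hirr'.ne_zero.symm, Int.fract_lt_one _⟩,
    fun i => ?_⟩
  have := hK (i + 1)
  rwa [Function.iterate_succ_apply] at this

/-- One step of the continued fraction algorithm. -/
theorem exists_gauss_step (h : α ∈ BoundedType K) :
    ∃ a : ℤ, 1 ≤ a ∧ a ≤ K ∧ α * (a + gaussMap α) = 1 := by
  obtain ⟨-, ⟨h0, h1⟩, hK⟩ := h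
  refine ⟨⌊1 / α⌋, ?_, hK 0, ?_⟩
  · rw [Int.le_floor]; push_cast; exact (one_le_div h0).2 h1.le
  · rw [gaussMap, Int.floor_add_fract]; field_simp

theorem one_le_mul_of_boundedType (h : α ∈ BoundedType K) : 1 ≤ (K + 1) * α := by
  obtain ⟨a, -, ha, hs⟩ := exists_gauss_step h
  have h1 := (gaussMap_mem_boundedType h).2.1.2
  have h0 := h.2.1.1
  have : (a : ℝ) ≤ K := by exact_mod_cast ha
  nlinarith

/-- Approximation from above. The proof is a descent: with `q = p' + p a` and `p'` positive, two
steps of the continued fraction algorithm lead from `(α, p, q)` to `(G² α, p - p' b, p')`, where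
`G` is the Gauss map, without increasing `q (p - q α)`; for `p' ≤ 0` the bound is elementary. -/
theorem le_mul_sub_of_lt (n : ℕ) : ∀ {α : ℝ}, α ∈ BoundedType K → ∀ p q : ℤ, 1 ≤ q → q ≤ n →
    q * α < p → 1 ≤ 2 * (K + 1) * (q * (p - q * α)) := by
  induction n using Nat.strong_induction_on with
  | _ n ih =>
  intro α hα p q hq hqn hlt
  obtain ⟨a, ha1, haK, ha⟩ := exists_gauss_step hα
  have hx := gaussMap_mem_boundedType hα
  set x := gaussMap α
  obtain ⟨b, hb1, hbK, hb⟩ := exists_gauss_step hx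
  have hy := gaussMap_mem_boundedType hx
  set y := gaussMap x
  have hα0 := hα.2.1.1
  have hx0 := hx.2.1.1
  have hx1 := hx.2.1.2
  have hαK := one_le_mul_of_boundedType hα
  have hxK := one_le_mul_of_boundedType hx
  have hqR : (1 : ℝ) ≤ q := by exact_mod_cast hq
  have haR : (1 : ℝ) ≤ a := by exact_mod_cast ha1
  have hK0 : (0 : ℝ) ≤ K := Nat.cast_nonneg K
  have hp1 : 1 ≤ p := by
    have : (0 : ℝ) < p := lt_of_le_of_lt (by positivity) hlt
    exact_mod_cast this
  have hpR : (1 : ℝ) ≤ p := by exact_mod_cast hp1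
  obtain ⟨p', hp'⟩ : ∃ p' : ℤ, q = p' + p * a := ⟨q - p * a, by ring⟩
  have hqe : (q : ℝ) = p' + p * a := by rw [hp']; push_cast; ring
  -- `p - q α = α (p x - p')`
  have hd : (p : ℝ) - q * α = α * (p * x - p') := by rw [hqe]; linear_combination (-(p : ℝ)) * ha
  have hd' : 0 < (p : ℝ) * x - p' := by
    have : 0 < α * (p * x - p') := by rw [← hd]; linarith
    exact pos_of_mul_pos_right this hα0.le
  rcases lt_trichotomy p' 0 with hneg | hzero | hpos
  · have h1 : (p' : ℝ) ≤ -1 := by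
      have : p' ≤ -1 := by omega
      exact_mod_cast this
    have h2 : 1 ≤ (p : ℝ) * x - p' := by nlinarith
    rw [hd]
    have h3 : α ≤ q * (α * (p * x - p')) := by
      calc α = 1 * (α * 1) := by ring
        _ ≤ _ := by gcongr
    nlinarith
  · rw [hd, hqe, hzero]
    have hαx : α * x ≤ 1 / 2 := by nlinarith
    have h4 : x / 2 ≤ ((0 : ℤ) + p * a : ℝ) * (α * (p * x - (0 : ℤ))) := by
      have : ((0 : ℤ) + p * a : ℝ) * (α * (p * x - (0 : ℤ))) = (p * p) * (x * (1 - α * x)) := by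
        push_cast; linear_combination ((p : ℝ) * p * x) * ha
      rw [this]
      have h5 : x / 2 ≤ x * (1 - α * x) := by nlinarith
      have h6 : (1 : ℝ) ≤ p * p := by nlinarith
      nlinarith
    calc (1 : ℝ) ≤ 2 * (K + 1) * (x / 2) := by linarith
      _ ≤ _ := by gcongr
  · have hp'q : p' < q := by nlinarith
    have hp'R : (1 : ℝ) ≤ p' := by exact_mod_cast hpos
    have hdd : (p : ℝ) * x - p' = x * ((p - p' * b : ℤ) - p' * y) := by
      push_cast; linear_combination (p' : ℝ) * hb
    have hdd' : 0 < ((p - p' * b : ℤ) : ℝ) - p' * y := by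
      rw [hdd] at hd'; exact pos_of_mul_pos_right hd' hx0.le
    have key := ih p'.toNat (by omega) hy (p - p' * b) p' hpos (by omega) (by linarith)
    refine key.trans ?_
    rw [hd, hdd]
    have h7 : (p' : ℝ) ≤ q * (α * x) := by
      have : q * (α * x) = p' + (p * x - p') * (a * α) := by
        rw [hqe]; linear_combination ((p' : ℝ)) * ha
      rw [this]
      have : 0 ≤ (p * x - p') * (a * α) := by positivity
      linarith
    calc 2 * ((K : ℝ) + 1) * (p' * (((p - p' * b : ℤ) : ℝ) - p' * y))
        ≤ 2 * (K + 1) * ((q * (α * x)) * (((p - p' * b : ℤ) : ℝ) - p' * y)) := by gcongr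
      _ = _ := by ring

/-- Numbers of bounded type are badly approximable, uniformly in the bound. -/
theorem one_le_mul_abs_sub (hα : α ∈ BoundedType K) {k : ℤ} (hk : k ≠ 0) (n : ℤ) :
    1 ≤ 2 * (K + 1) * (|(k : ℝ)| * |k * α - n|) := by
  have hα0 := hα.2.1.1
  have hpos : ∀ (q p : ℤ), 1 ≤ q → 1 ≤ 2 * ((K : ℝ) + 1) * (q * |q * α - p|) := by
    intro q p hq
    have hqR : (1 : ℝ) ≤ q := by exact_mod_cast hq
    have hne : (q : ℝ) * α - p ≠ 0 := by
      have := (hα.1.intCast_mul (m := q) (by omega)).sub_intCast p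
      exact this.ne_zero
    -- One further step of the algorithm turns approximation from below into one from above.
    rcases lt_or_gt_of_ne hne with h | h
    · rw [abs_of_neg h, neg_sub]
      exact le_mul_sub_of_lt q.toNat hα p q hq (by omega) (by linarith)
    · rw [abs_of_pos h]
      have hαK := one_le_mul_of_boundedType hα
      rcases le_or_gt p 0 with hp | hp
      · have hpR : (p : ℝ) ≤ 0 := by exact_mod_cast hp
        have : α ≤ q * (q * α - p) := by nlinarith
        nlinarith
      · obtain ⟨a, ha1, haK, ha⟩ := exists_gauss_step hα
        have hx := gaussMap_mem_boundedType hα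
        set x := gaussMap α
        have hd : (q : ℝ) * α - p = α * ((q - p * a : ℤ) - p * x) := by
          push_cast; linear_combination ((p : ℝ)) * ha
        have hd' : 0 < ((q - p * a : ℤ) : ℝ) - p * x := by
          rw [hd] at h; exact pos_of_mul_pos_right h hα0.le
        have key := le_mul_sub_of_lt p.toNat hx (q - p * a) p hp (by omega) (by linarith)
        refine key.trans ?_
        rw [hd, ← mul_assoc (q : ℝ)]
        gcongr
        linarith
  rcases lt_or_gt_of_ne hk with h | h
  · have := hpos (-k) (-n) (by omega)
    push_cast at this
    have h2 : |(k : ℝ)| = -k := abs_of_neg (by exact_mod_cast h)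
    rw [h2]
    rwa [show -(k : ℝ) * α - -(n : ℝ) = -(k * α - n) by ring, abs_neg] at this
  · have h2 : |(k : ℝ)| = k := abs_of_pos (by exact_mod_cast h)
    rw [h2]; exact hpos k n h

/-- The small divisors are at least a constant multiple of `1 / |k|`. -/
theorem one_le_mul_norm_fourierExp_sub_one (hα : α ∈ BoundedType K) {k : ℤ} (hk : k ≠ 0) :
    1 ≤ (K + 1) * (|(k : ℝ)| * ‖fourierExp k α - 1‖) := by
  set t : ℝ := k * α - round (k * α) with ht
  have h1 : fourierExp k α = Complex.exp (I * (2 * Real.pi * t : ℝ)) := by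
    rw [fourierExp, Complex.exp_eq_exp_iff_exists_int]
    refine ⟨round (k * α), ?_⟩
    rw [ht]; push_cast; ring
  have h2 : |t| ≤ 1 / 2 := abs_sub_round _
  have h3 : 4 * |t| ≤ ‖fourierExp k α - 1‖ := by
    rw [h1, Complex.norm_exp_I_mul_ofReal_sub_one, norm_mul, Real.norm_eq_abs, Real.norm_eq_abs,
      abs_two]
    have := Real.mul_abs_le_abs_sin (x := 2 * Real.pi * t / 2) (by
      rw [abs_div, abs_mul, abs_mul, abs_two, abs_of_pos Real.pi_pos]
      nlinarith [Real.pi_pos])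
    have h4 : 2 / Real.pi * |2 * Real.pi * t / 2| = 2 * |t| := by
      rw [abs_div, abs_mul, abs_mul, abs_two, abs_of_pos Real.pi_pos]
      have := Real.pi_pos.ne'
      field_simp
    linarith
  have h5 := one_le_mul_abs_sub hα hk (round (k * α))
  calc (1 : ℝ) ≤ 2 * (K + 1) * (|(k : ℝ)| * |t|) := h5
    _ ≤ (K + 1) * (|(k : ℝ)| * (4 * |t|)) := by
      have : 0 ≤ (K + 1) * (|(k : ℝ)| * |t|) := by positivity
      nlinarith
    _ ≤ _ := by gcongr

end BoundedType

/-! ### Analytic nonlinear operators on Banach algebras -/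

section PowerSum

variable {B X : Type*} [NormedAddCommGroup B] [NormedSpace ℂ B]
  [NormedCommRing X] [NormedAlgebra ℂ X]

/-- The power series `∑ φₙ xⁿ` in a Banach algebra with coefficients `φₙ` depending linearly on a
parameter. -/
def functionalSeries (X : Type*) [NormedCommRing X] [NormedAlgebra ℂ X] (φ : ℕ → B →L[ℂ] ℂ) :
    FormalMultilinearSeries ℂ X (B →L[ℂ] X) := fun n =>
  (ContinuousLinearMap.smulRightL ℂ B X (φ n)).compContinuousMultilinearMap
    (ContinuousMultilinearMap.mkPiAlgebraFin ℂ n X)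

theorem functionalSeries_apply (φ : ℕ → B →L[ℂ] ℂ) (n : ℕ) (x : X) (g : B) :
    functionalSeries X φ n (fun _ => x) g = φ n g • x ^ n := by
  simp [functionalSeries]

variable {φ : ℕ → B →L[ℂ] ℂ} {r : ℝ≥0}

theorem le_radius_functionalSeries (hφ : Summable fun n => ‖φ n‖ * (r : ℝ) ^ n) :
    (r : ℝ≥0∞) ≤ (functionalSeries X φ).radius := by
  refine FormalMultilinearSeries.le_radius_of_summable _ ?_
  refine Summable.of_nonneg_of_le (fun _ => by positivity) (fun n => ?_)
    (hφ.mul_left (max 1 ‖(1 : X)‖))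
  have h1 : ‖functionalSeries X φ n‖ ≤ ‖φ n‖ * max 1 ‖(1 : X)‖ := by
    refine (ContinuousLinearMap.norm_compContinuousMultilinearMap_le _ _).trans ?_
    gcongr
    · exact ContinuousLinearMap.opNorm_le_bound _ (norm_nonneg _) fun f => by simp
    · exact ContinuousMultilinearMap.norm_mkPiAlgebraFin_le
  calc _ ≤ ‖φ n‖ * max 1 ‖(1 : X)‖ * (r : ℝ) ^ n := by gcongr
    _ = _ := by ring

/-- The sum `∑ φₙ(g) xⁿ` in a Banach algebra. -/
def functionalSum (φ : ℕ → B →L[ℂ] ℂ) (g : B) (x : X) : X := (functionalSeries X φ).sum x g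

theorem functionalSum_zero (x : X) : functionalSum φ 0 x = 0 := map_zero _

variable [CompleteSpace X]

theorem hasSum_functionalSum (hφ : Summable fun n => ‖φ n‖ * (r : ℝ) ^ n) (g : B) {x : X}
    (hx : ‖x‖ < r) : HasSum (fun n => φ n g • x ^ n) (functionalSum φ g x) := by
  have h := (functionalSeries X φ).hasSum (x := x)
    (Metric.eball_subset_eball (le_radius_functionalSeries hφ)
      (by simpa [edist_zero_right, enorm_eq_nnnorm, ← NNReal.coe_lt_coe] using hx))
  have := (ContinuousLinearMap.apply ℂ X g).hasSum h
  simp only [ContinuousLinearMap.apply_apply, functionalSeries_apply] at this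
  exact this

theorem analyticAt_functionalSum (hφ : Summable fun n => ‖φ n‖ * (r : ℝ) ^ n) (g : B) {x : X}
    (hx : ‖x‖ < r) : AnalyticAt ℂ (fun q : B × X => functionalSum φ q.1 q.2) (g, x) := by
  have hr : (0 : ℝ≥0∞) < r := by
    have : (0 : ℝ) < r := (norm_nonneg x).trans_lt hx
    exact_mod_cast this
  have hrad := le_radius_functionalSeries (X := X) hφ
  have h := ((functionalSeries X φ).hasFPowerSeriesOnBall (hr.trans_le hrad)).analyticAt_of_mem
    (y := x) (Metric.eball_subset_eball hrad
      (by simpa [edist_zero_right, enorm_eq_nnnorm, ← NNReal.coe_lt_coe] using hx))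
  have h2 : AnalyticAt ℂ (fun q : B × X => (functionalSeries X φ).sum q.2) (g, x) :=
    AnalyticAt.fun_comp (f := Prod.snd) (x := (g, x)) h analyticAt_snd
  exact AnalyticAt.fun_comp (f := fun q : B × X => ((functionalSeries X φ).sum q.2, q.1))
    ((ContinuousLinearMap.id ℂ (B →L[ℂ] X)).analyticAt_bilinear _) (h2.prod analyticAt_fst)

end PowerSum

/-- Implicit function theorem at a point where the partial derivative is the identity. -/
theorem exists_analyticAt_implicit {B X : Type*} [NormedAddCommGroup B] [NormedSpace ℂ B]
    [CompleteSpace B] [NormedAddCommGroup X] [NormedSpace ℂ X] [CompleteSpace X]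
    {Θ : B × X → X} (hΘ : AnalyticAt ℂ Θ (0, 0)) (h0 : Θ (0, 0) = 0)
    (hd : HasFDerivAt (fun ψ => Θ (0, ψ)) (ContinuousLinearMap.id ℂ X) 0) :
    ∃ ψ : B → X, AnalyticAt ℂ ψ 0 ∧ ψ 0 = 0 ∧ ∀ᶠ g in 𝓝 (0 : B), Θ (g, ψ g) = 0 := by
  have hc : ContDiffAt ℂ ω Θ (0, 0) := hΘ.contDiffAt
  have hinv : (fderiv ℂ Θ (0, 0) ∘L .inr ℂ B X).IsInvertible := by
    have h1 : HasFDerivAt (fun ψ => Θ (0, ψ)) (fderiv ℂ Θ (0, 0) ∘L .inr ℂ B X) 0 :=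
      HasFDerivAt.comp (f := fun ψ : X => ((0 : B), ψ)) 0 hΘ.differentiableAt.hasFDerivAt
        (hasFDerivAt_prodMk_right 0 0)
    rw [h1.unique hd]
    exact ⟨ContinuousLinearEquiv.refl ℂ X, rfl⟩
  refine ⟨hc.implicitFunction (by simp) hinv, ?_, ?_, ?_⟩
  · exact (hc.contDiffAt_implicitFunction (by simp) hinv).analyticAt
  · exact hc.implicitFunction_apply_self (by simp) hinv
  · have := hc.eventually_apply_implicitFunction (by simp) hinv
    simpa [h0] using this

section Equation

variable {B X : Type*} [NormedAddCommGroup B] [NormedSpace ℂ B]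
  [NormedCommRing X] [NormedAlgebra ℂ X]

/-- Composition of a Fourier series with `id + p`, written in terms of the modes: if `e` and `e'`
stand for `exp (± 2πiz)`, then `e exp (2πip)` and `e' exp (-2πip)` stand for `exp (± 2πi (z + p))`,
and the coefficients `φₙ g`, `φ'ₙ g` are those of the modes of index `n` and `-n`. -/
def composeSum (φ φ' : ℕ → B →L[ℂ] ℂ) (e e' : X) (g : B) (p : X) : X :=
  functionalSum φ g (e * NormedSpace.exp ((2 * Real.pi * I : ℂ) • p)) +
    functionalSum φ' g (e' * NormedSpace.exp (-((2 * Real.pi * I : ℂ) • p)))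

variable {φ φ' : ℕ → B →L[ℂ] ℂ} {r : ℝ≥0} {e e' : X}

theorem composeSum_zero (p : X) : composeSum φ φ' e e' (0 : B) p = 0 := by
  simp [composeSum, functionalSum_zero]

variable [CompleteSpace X]

theorem AnalyticAt.normedSpace_exp {V : Type*} [NormedAddCommGroup V] [NormedSpace ℂ V]
    {f : V → X} {v : V} (hf : AnalyticAt ℂ f v) :
    AnalyticAt ℂ (fun w => NormedSpace.exp (f w)) v :=
  AnalyticAt.fun_comp (g := (NormedSpace.exp : X → X)) (NormedSpace.exp_analytic (𝕂 := ℂ) _) hf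

theorem AnalyticAt.clm_comp {V X : Type*} [NormedAddCommGroup V] [NormedSpace ℂ V]
    [NormedAddCommGroup X] [NormedSpace ℂ X] (L : X →L[ℂ] X)
    {f : V → X} {v : V} (hf : AnalyticAt ℂ f v) : AnalyticAt ℂ (fun w => L (f w)) v :=
  AnalyticAt.fun_comp (g := L) (L.analyticAt _) hf

theorem AnalyticAt.functionalSum {V : Type*} [NormedAddCommGroup V] [NormedSpace ℂ V]
    (hφ : Summable fun n => ‖φ n‖ * (r : ℝ) ^ n) {f : V → B} {h : V → X} {v : V}
    (hf : AnalyticAt ℂ f v) (hh : AnalyticAt ℂ h v) (hr : ‖h v‖ < r) :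
    AnalyticAt ℂ (fun w => functionalSum φ (f w) (h w)) v :=
  AnalyticAt.fun_comp (g := fun q : B × X => _root_.functionalSum φ q.1 q.2)
    (f := fun w => (f w, h w)) (analyticAt_functionalSum hφ (f v) hr) (hf.prod hh)

theorem AnalyticAt.composeSum {V : Type*} [NormedAddCommGroup V] [NormedSpace ℂ V]
    (hφ : Summable fun n => ‖φ n‖ * (r : ℝ) ^ n)
    (hφ' : Summable fun n => ‖φ' n‖ * (r : ℝ) ^ n) (he : ‖e‖ < r) (he' : ‖e'‖ < r)
    {f : V → B} {p : V → X} {v : V} (hf : AnalyticAt ℂ f v) (hp : AnalyticAt ℂ p v)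
    (hp0 : p v = 0) : AnalyticAt ℂ (fun w => composeSum φ φ' e e' (f w) (p w)) v := by
  have hs : AnalyticAt ℂ (fun w => (2 * Real.pi * I : ℂ) • p w) v := analyticAt_const.fun_smul hp
  exact (AnalyticAt.functionalSum hφ hf (analyticAt_const.mul hs.normedSpace_exp)
    (by simpa [hp0] using he)).add
    (AnalyticAt.functionalSum hφ' hf (analyticAt_const.mul hs.neg.normedSpace_exp)
    (by simpa [hp0] using he'))

/-- Solution of the fixed point equation satisfied by the logarithm `ψ` of the derivative of a
conjugacy. At `g = 0` the linearization at `ψ = 0` is the identity, since the terms `P ψ - P (exp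
ψ)` cancel to first order. Here `M` is the inverse of the cohomological operator, `R` the rotation,
`P` the mean, and `J` the primitive. -/
theorem exists_analytic_solution [CompleteSpace B] (hφ : Summable fun n => ‖φ n‖ * (r : ℝ) ^ n)
    (hφ' : Summable fun n => ‖φ' n‖ * (r : ℝ) ^ n) (he : ‖e‖ < r) (he' : ‖e'‖ < r)
    {M R P J : X →L[ℂ] X} (hP : P 1 = 1) (hJ : J 1 = 0) :
    ∃ ψ : B → X, AnalyticAt ℂ ψ 0 ∧ ψ 0 = 0 ∧ ∀ᶠ g in 𝓝 (0 : B),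
      ψ g = M (composeSum φ φ' e e' g (J (NormedSpace.exp (ψ g))) *
        NormedSpace.exp ((2 : ℂ) • ψ g - R (ψ g))) + P (ψ g) - P (NormedSpace.exp (ψ g)) + 1 := by
  let Θ : B × X → X := fun q => q.2 - (M (composeSum φ φ' e e' q.1 (J (NormedSpace.exp q.2)) *
        NormedSpace.exp ((2 : ℂ) • q.2 - R q.2)) + P q.2 - P (NormedSpace.exp q.2) + 1)
  have hsnd : AnalyticAt ℂ (fun q : B × X => q.2) (0, 0) := analyticAt_snd
  have hexp : AnalyticAt ℂ (fun q : B × X => NormedSpace.exp q.2) (0, 0) := hsnd.normedSpace_exp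
  have hc : AnalyticAt ℂ
      (fun q : B × X => composeSum φ φ' e e' q.1 (J (NormedSpace.exp q.2))) (0, 0) :=
    AnalyticAt.composeSum hφ hφ' he he' analyticAt_fst (hexp.clm_comp J) (by simp [hJ])
  have he2 : AnalyticAt ℂ
      (fun q : B × X => NormedSpace.exp ((2 : ℂ) • q.2 - R q.2)) (0, 0) :=
    ((analyticAt_const.fun_smul hsnd).fun_sub (hsnd.clm_comp R)).normedSpace_exp
  have hΘ : AnalyticAt ℂ Θ (0, 0) :=
    hsnd.sub (((((hc.mul he2).clm_comp M).add (hsnd.clm_comp P)).sub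
      (hexp.clm_comp P)).add analyticAt_const)
  have h0 : Θ (0, 0) = 0 := by simp [Θ, composeSum_zero, hP]
  have hd : HasFDerivAt (fun ψ => Θ (0, ψ)) (ContinuousLinearMap.id ℂ X) 0 := by
    have h1 : (fun ψ => Θ (0, ψ)) = fun ψ => ψ - (P ψ - P (NormedSpace.exp ψ) + 1) := by
      funext ψ; simp [Θ, composeSum_zero]
    rw [h1]
    have h2 : HasFDerivAt (NormedSpace.exp : X → X) (1 : X →L[ℂ] X) 0 := hasFDerivAt_exp_zero
    have h3 := (hasFDerivAt_id (𝕜 := ℂ) (0 : X)).sub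
      (((P.hasFDerivAt (x := 0)).sub (P.hasFDerivAt.comp (0 : X) h2)).add_const 1)
    refine h3.congr_fderiv ?_
    ext x; simp
  obtain ⟨ψ, h1, h2, h3⟩ := exists_analyticAt_implicit hΘ h0 hd
  refine ⟨ψ, h1, h2, h3.mono fun g hg => ?_⟩
  exact sub_eq_zero.1 hg

end Equation

/-! ### Herman's trick -/

theorem integral_eq_sub_of_strip {σ : ℝ} (hσ : 0 < σ) {f f' : ℂ → ℂ}
    (hf : ∀ z : ℂ, |z.im| < σ → HasDerivAt f (f' z) z)
    (hc : ContinuousOn f' {z : ℂ | |z.im| < σ}) :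
    ∫ x in (0 : ℝ)..1, f' x = f 1 - f 0 := by
  have h := intervalIntegral.integral_eq_sub_of_hasDerivAt (a := 0) (b := 1)
    (f := fun x : ℝ => f x) (f' := fun x : ℝ => f' x)
    (fun x _ => (hf x (by simpa using hσ)).comp_ofReal) (by
      refine Continuous.intervalIntegrable ?_ _ _
      exact hc.comp_continuous Complex.continuous_ofReal (fun x => by simpa using hσ))
  simpa using h

theorem exists_const_of_hasDerivAt_zero {σ : ℝ} (hσ : 0 < σ) {f : ℂ → ℂ}
    (hf : ∀ z : ℂ, |z.im| < σ → HasDerivAt f 0 z) :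
    ∃ c, ∀ z : ℂ, |z.im| < σ → f z = c := by
  refine ⟨f 0, fun z hz => ?_⟩
  refine (isOpen_imStrip σ).is_const_of_deriv_eq_zero (convex_imStrip σ).isPreconnected
    (fun z hz => (hf z hz).differentiableAt.differentiableWithinAt)
    (fun z hz => (hf z hz).deriv) hz (by simpa using hσ)

/-- Herman's trick. Let `h = id + p` and `U = log h'`. If `U` satisfies the twice differentiated
conjugacy equation up to an additive constant `v₀`, then `h` satisfies the conjugacy equation
`h ∘ R_α = R_α ∘ h + G ∘ h + c` for some constant `c`: integrating over a period shows that the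
constants which appear on the way vanish. -/
theorem exists_const_conjugacy_of_logDeriv {σ σ₁ α : ℝ} (hσ : 0 < σ) {p U G G₁ G₂ : ℂ → ℂ} {v₀ : ℂ}
    (hp1 : ∀ z, p (z + 1) = p z) (hU1 : ∀ z, U (z + 1) = U z)
    (hG1 : ∀ z, G (z + 1) = G z) (hG11 : ∀ z, G₁ (z + 1) = G₁ z)
    (hU : ContinuousOn U {z : ℂ | |z.im| < σ})
    (hp : ∀ z : ℂ, |z.im| < σ → HasDerivAt p (Complex.exp (U z) - 1) z)
    (hG : ∀ z : ℂ, |z.im| < σ₁ → HasDerivAt G (G₁ z) z)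
    (hG' : ∀ z : ℂ, |z.im| < σ₁ → HasDerivAt G₁ (G₂ z) z)
    (hh : ∀ z : ℂ, |z.im| < σ → |(z + p z).im| < σ₁)
    (hD : ∀ z : ℂ, |z.im| < σ → HasDerivAt (fun z => U (z + α) - U z)
      (G₂ (z + p z) * Complex.exp (2 * U z - U (z + α)) - v₀) z)
    (hw : ∀ z : ℂ, |z.im| < σ → ‖Complex.exp (U (z + α) - U z) - 1‖ ≤ 1 / 2) :
    ∃ c, ∀ z : ℂ, |z.im| < σ → p (z + α) - p z = G (z + p z) + c := by
  have hpc : ContinuousOn p {z : ℂ | |z.im| < σ} := fun z hz =>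
    (hp z hz).continuousAt.continuousWithinAt
  have hmaps : Set.MapsTo (fun z : ℂ => z + α) {z : ℂ | |z.im| < σ} {z : ℂ | |z.im| < σ} := by
    intro z hz; simpa using hz
  have hUα : ContinuousOn (fun z => U (z + α)) {z : ℂ | |z.im| < σ} :=
    hU.comp (by fun_prop) hmaps
  have hwc : ContinuousOn (fun z => Complex.exp (U (z + α) - U z)) {z : ℂ | |z.im| < σ} :=
    Complex.continuous_exp.comp_continuousOn (hUα.sub hU)
  have hh1 : ∀ z : ℂ, |z.im| < σ → HasDerivAt (fun z => z + p z) (Complex.exp (U z)) z := by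
    intro z hz
    exact ((hasDerivAt_id z).add (hp z hz)).congr_deriv (by ring)
  -- `h' ∘ R / h' - g' ∘ h` has derivative `-v₀ h' ∘ R / h'`
  have hW : ∀ z : ℂ, |z.im| < σ →
      HasDerivAt (fun z => Complex.exp (U (z + α) - U z) - G₁ (z + p z))
        (-v₀ * Complex.exp (U (z + α) - U z)) z := by
    intro z hz
    refine ((hD z hz).cexp.sub ((hG' _ (hh z hz)).comp z (hh1 z hz))).congr_deriv ?_
    have : Complex.exp (U (z + α) - U z) * Complex.exp (2 * U z - U (z + α)) =
      Complex.exp (U z) := by rw [← Complex.exp_add]; congr 1; ring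
    linear_combination G₂ (z + p z) * this
  have hv₀ : v₀ = 0 := by
    have h1 := integral_eq_sub_of_strip hσ hW (continuousOn_const.mul hwc)
    have h2 : (1 : ℂ) + α = (0 + α) + 1 := by ring
    have h3 := hU1 (0 + α)
    have h4 := hU1 0
    have h5 := hp1 0
    have h6 := hG11 (0 + p 0)
    rw [zero_add] at h4 h5
    rw [h2, h3, h4, h5, show (1 : ℂ) + p 0 = 0 + p 0 + 1 by ring, h6, sub_self,
      intervalIntegral.integral_const_mul, mul_eq_zero, neg_eq_zero] at h1
    -- The integral of `h' ∘ R / h'` is not zero, because this quotient is close to one.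
    refine h1.resolve_right fun h7 => ?_
    have hint : IntervalIntegrable (fun x : ℝ => Complex.exp (U (x + α) - U x))
        MeasureTheory.volume 0 1 :=
      (hwc.comp_continuous Complex.continuous_ofReal
        (fun x => by simpa using hσ)).intervalIntegrable _ _
    have h8 : ∫ x in (0 : ℝ)..1, (Complex.exp (U (x + α) - U x) - 1) = -1 := by
      rw [intervalIntegral.integral_sub hint intervalIntegrable_const, h7]; simp
    have h9 := intervalIntegral.norm_integral_le_of_norm_le_const (a := 0) (b := 1)
      (f := fun x : ℝ => Complex.exp (U (x + α) - U x) - 1) (C := 1 / 2)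
      (fun x _ => hw x (by simpa using hσ))
    rw [h8] at h9
    norm_num at h9
  obtain ⟨b, hb⟩ := exists_const_of_hasDerivAt_zero hσ
    (fun z hz => (hW z hz).congr_deriv (by rw [hv₀]; ring))
  have hQ : ∀ z : ℂ, |z.im| < σ →
      HasDerivAt (fun z => p (z + α) - p z - G (z + p z)) ((b - 1) * Complex.exp (U z)) z := by
    intro z hz
    have h1 : HasDerivAt (fun z => p (z + α)) (Complex.exp (U (z + α)) - 1) z :=
      (hp (z + α) (hmaps hz)).comp_add_const z (α : ℂ)
    refine ((h1.sub (hp z hz)).sub ((hG _ (hh z hz)).comp z (hh1 z hz))).congr_deriv ?_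
    have h2 : Complex.exp (U (z + α) - U z) * Complex.exp (U z) = Complex.exp (U (z + α)) := by
      rw [← Complex.exp_add]; congr 1; ring
    linear_combination (Complex.exp (U z)) * hb z hz - h2
  have hb1 : b - 1 = 0 := by
    have h1 := integral_eq_sub_of_strip hσ hQ
      (continuousOn_const.mul (Complex.continuous_exp.comp_continuousOn hU))
    have h1' := integral_eq_sub_of_strip hσ hh1
      (Complex.continuous_exp.comp_continuousOn hU)
    have h2 : (1 : ℂ) + α = (0 + α) + 1 := by ring
    have h3 := hp1 (0 + α)
    have h5 := hp1 0
    have h6 := hG1 (0 + p 0)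
    rw [zero_add] at h5
    rw [h5] at h1'
    rw [h2, h3, h5, show (1 : ℂ) + p 0 = 0 + p 0 + 1 by ring, h6, sub_self,
      intervalIntegral.integral_const_mul, h1'] at h1
    linear_combination h1
  obtain ⟨c, hc⟩ := exists_const_of_hasDerivAt_zero hσ
    (fun z hz => (hQ z hz).congr_deriv (by rw [hb1]; ring))
  exact ⟨c, fun z hz => by linear_combination hc z hz⟩

/-! ### Elements of the Wiener algebra as functions -/

namespace Wiener

variable {δ : ℝ≥0}

/-- The function `z ↦ ∑ uₖ exp (2πikz)` represented by an element of the Wiener algebra; it is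
meaningful on the closed strip of half-width `δ`. -/
def eval (u : Wiener δ) (z : ℂ) : ℂ := ∑' k, coeff k u * fourierExp k z

theorem evalHom_eq_eval {z : ℂ} (hz : |z.im| ≤ δ) (u : Wiener δ) : evalHom z hz u = u.eval z :=
  (hasSum_evalHom hz u).tsum_eq.symm

theorem eval_add_one (u : Wiener δ) (z : ℂ) : u.eval (z + 1) = u.eval z := by
  simp [eval, fourierExp_add, fourierExp_one]

theorem norm_coeff_le_exp (u : Wiener δ) (k : ℤ) :
    ‖coeff k u‖ ≤ ‖u‖ * Real.exp (-(2 * Real.pi * δ * |(k : ℝ)|)) := by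
  rw [Real.exp_neg]; exact norm_coeff_le k u

theorem hasDerivAt_eval (u : Wiener δ) {z : ℂ} (hz : |z.im| < δ) :
    HasDerivAt u.eval (∑' k, 2 * Real.pi * I * k * coeff k u * fourierExp k z) z :=
  hasDerivAt_fourierSeries (norm_coeff_le_exp u) hz

theorem continuousOn_eval (u : Wiener δ) : ContinuousOn u.eval {z : ℂ | |z.im| < δ} :=
  fun _ hz => (hasDerivAt_eval u hz).continuousAt.continuousWithinAt

theorem hasDerivAt_eval_of_coeff {u v : Wiener δ}
    (h : ∀ k, 2 * Real.pi * I * k * coeff k u = coeff k v) {z : ℂ} (hz : |z.im| < δ) :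
    HasDerivAt u.eval (v.eval z) z :=
  (hasDerivAt_eval u hz).congr_deriv (by simp only [h]; rfl)

/-- The mean of the represented function over a period is the zeroth coefficient. -/
theorem integral_eval (u : Wiener δ) : ∫ x in (0 : ℝ)..1, u.eval x = coeff 0 u := by
  have hs : ∀ x : ℝ, |(x : ℂ).im| ≤ δ := fun x => by simp
  have hu : ∀ x : ℝ, ∀ k, ‖coeff k u * fourierExp k x‖ = ‖coeff k u‖ := fun x k => by
    rw [norm_mul, norm_fourierExp]; simp
  have hsum : Summable fun k => ‖coeff k u‖ := by
    refine Summable.of_nonneg_of_le (fun _ => norm_nonneg _) (fun k => ?_)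
      (hasSum_norm_coeff u).summable
    refine le_mul_of_one_le_right (norm_nonneg _) (Real.one_le_exp ?_)
    positivity
  have h := intervalIntegral.hasSum_integral_of_dominated_convergence
    (μ := MeasureTheory.volume) (a := 0) (b := 1)
    (F := fun k (x : ℝ) => coeff k u * fourierExp k x) (f := fun x : ℝ => u.eval x)
    (fun k _ => ‖coeff k u‖)
    (fun k => ((differentiable_fourierExp k).continuous.comp
      Complex.continuous_ofReal).aestronglyMeasurable.const_mul _)
    (fun k => .of_forall fun x _ => (hu x k).le) (by simp [hsum]) (by simp)
    (by
      filter_upwards with x _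
      rw [← evalHom_eq_eval (hs x)]
      exact hasSum_evalHom (hs x) u)
  refine h.unique ?_
  convert! hasSum_ite_eq (0 : ℤ) (coeff 0 u) using 2 with k
  split_ifs with hk
  · subst hk; simp
  · have h1 := integral_eq_sub_of_strip one_pos (f := fun z => (2 * Real.pi * I * k)⁻¹ *
      (coeff k u * fourierExp k z)) (f' := fun z => coeff k u * fourierExp k z)
      (fun z _ => (((hasDerivAt_fourierExp k z).const_mul (coeff k u)).const_mul _).congr_deriv (by
        have h3 : (2 * Real.pi * I * k : ℂ) ≠ 0 := by simp [hk, Real.pi_ne_zero]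
        field_simp))
      (continuousOn_const.mul (differentiable_fourierExp k).continuous.continuousOn)
    rw [h1]
    simp [fourierExp_one]
    simp [fourierExp]

end Wiener

open Wiener

/-! ### Bounded families in the Wiener algebra, and composition -/

section Family

/-- The Banach algebra of bounded families in the Wiener algebra. With the rotation number as
index, one application of the implicit function theorem yields estimates which are uniform in that
number. -/
abbrev WienerFamily (ι : Type) (δ : ℝ≥0) : Type := lp (fun _ : ι => Wiener δ) ∞

namespace WienerFamily

variable {ι : Type} {δ : ℝ≥0}

/-- The family with all members equal to `u`. -/
def const (ι : Type) (u : Wiener δ) : WienerFamily ι δ :=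
  ⟨fun _ => u, memℓp_infty ⟨‖u‖, by rintro _ ⟨i, rfl⟩; rfl⟩⟩

theorem norm_const_le (u : Wiener δ) : ‖const ι u‖ ≤ ‖u‖ :=
  lp.norm_le_of_forall_le (norm_nonneg u) fun _ => le_rfl

/-- The `i`-th member of a family, as an algebra homomorphism. -/
def proj (i : ι) : WienerFamily ι δ →ₐ[ℂ] Wiener δ :=
  AlgHom.ofLinearMap (lp.evalCLM ℂ (fun _ : ι => Wiener δ) ∞ i).toLinearMap rfl fun _ _ => rfl

theorem continuous_proj (i : ι) : Continuous (proj i : WienerFamily ι δ →ₐ[ℂ] Wiener δ) :=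
  (lp.evalCLM ℂ (fun _ : ι => Wiener δ) ∞ i).continuous

/-- Evaluation of the `i`-th member of a family at the point `z` of the closed strip. -/
def evalAt (i : ι) (z : ℂ) (hz : |z.im| ≤ δ) : WienerFamily ι δ →ₐ[ℂ] ℂ :=
  (evalHom z hz).comp (proj i)

variable {i : ι} {z : ℂ} (hz : |z.im| ≤ δ)

theorem evalAt_eq (x : WienerFamily ι δ) : evalAt i z hz x = (x i).eval z :=
  evalHom_eq_eval hz _

theorem continuous_evalAt : Continuous (evalAt i z hz) :=
  (continuous_evalHom hz).comp (continuous_proj i)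

theorem norm_evalAt_le (x : WienerFamily ι δ) : ‖evalAt i z hz x‖ ≤ ‖x‖ :=
  (norm_evalHom_le hz _).trans (lp.norm_apply_le_norm ENNReal.top_ne_zero x i)

theorem evalAt_exp (x : WienerFamily ι δ) :
    evalAt i z hz (NormedSpace.exp x) = Complex.exp (evalAt i z hz x) := by
  rw [Complex.exp_eq_exp_ℂ]
  let : NormedAlgebra ℚ (WienerFamily ι δ) := NormedAlgebra.restrictScalars ℚ ℂ _
  exact NormedSpace.map_exp (evalAt i z hz) (continuous_evalAt hz) x

end WienerFamily

end Family

section Compose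

variable {δ δ₁ : ℝ≥0}

/-- The coefficient functionals, at the modes of index `n ≥ 0`, of the Fourier multiplier with
symbol `s`. -/
def posCoeff (δ₁ : ℝ≥0) (s : ℤ → ℂ) (n : ℕ) : Wiener δ₁ →L[ℂ] ℂ := s n • coeff n

/-- The coefficient functionals, at the modes of index `-n ≤ 0`, of the Fourier multiplier with
symbol `s`. -/
def negCoeff (δ₁ : ℝ≥0) (s : ℤ → ℂ) (n : ℕ) : Wiener δ₁ →L[ℂ] ℂ := s (-n) • coeff (-n)

theorem opNorm_coeff_le (k : ℤ) :
    ‖(coeff k : Wiener δ₁ →L[ℂ] ℂ)‖ ≤ Real.exp (-(2 * Real.pi * δ₁ * |(k : ℝ)|)) :=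
  ContinuousLinearMap.opNorm_le_bound _ (Real.exp_pos _).le fun u => by
    rw [mul_comm]; exact norm_coeff_le_exp u k

theorem summable_posCoeff_negCoeff {s : ℤ → ℂ} {A : ℝ} {m : ℕ} (hs : ∀ k, ‖s k‖ ≤ A * |(k : ℝ)| ^ m)
    {δ₂ : ℝ} (hδ : δ₂ < δ₁) :
    (Summable fun n => ‖posCoeff δ₁ s n‖ * Real.exp (2 * Real.pi * δ₂) ^ n) ∧
    (Summable fun n => ‖negCoeff δ₁ s n‖ * Real.exp (2 * Real.pi * δ₂) ^ n) := by
  have h := Real.summable_pow_mul_exp_neg_nat_mul m (r := 2 * Real.pi * (δ₁ - δ₂))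
    (mul_pos (by positivity) (sub_pos.2 hδ))
  have key : ∀ (n : ℕ) (k : ℤ), |(k : ℝ)| = n →
      ‖s k • (coeff k : Wiener δ₁ →L[ℂ] ℂ)‖ * Real.exp (2 * Real.pi * δ₂) ^ n ≤
        A * (n ^ m * Real.exp (-(2 * Real.pi * (δ₁ - δ₂)) * n)) := by
    intro n k hk
    rw [norm_smul, ← Real.exp_nat_mul]
    have h1 := hs k
    have h2 := opNorm_coeff_le (δ₁ := δ₁) k
    rw [hk] at h1 h2
    calc _ ≤ (A * (n : ℝ) ^ m) * Real.exp (-(2 * Real.pi * δ₁ * n)) *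
          Real.exp (n * (2 * Real.pi * δ₂)) := by
          have h0 := (norm_nonneg _).trans h1
          gcongr
      _ = _ := by rw [mul_assoc, ← Real.exp_add, mul_assoc]; congr 3; ring
  constructor
  · exact Summable.of_nonneg_of_le (fun _ => by positivity)
      (fun n => key n n (by simp)) (h.mul_left A)
  · exact Summable.of_nonneg_of_le (fun _ => by positivity)
      (fun n => key n (-n) (by simp)) (h.mul_left A)

variable {ι : Type}

/-- The composition of the function `∑ sₖ gₖ exp (2πikz)` with `id + p`, for a family `p`. The
constant term `s₀ g₀` is counted twice, once with the nonnegative and once with the nonpositive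
modes. -/
def composeFamily (s : ℤ → ℂ) (g : Wiener δ₁) (p : WienerFamily ι δ) : WienerFamily ι δ :=
  composeSum (posCoeff δ₁ s) (negCoeff δ₁ s) (WienerFamily.const ι (mode 1))
    (WienerFamily.const ι (mode (-1))) g p

theorem evalAt_composeFamily {s : ℤ → ℂ} {A : ℝ} {m : ℕ} (hs : ∀ k, ‖s k‖ ≤ A * |(k : ℝ)| ^ m)
    {δ₂ : ℝ} (hδ : δ₂ < δ₁) (g : Wiener δ₁) (p : WienerFamily ι δ)
    (h1 : ‖WienerFamily.const ι (mode 1) * NormedSpace.exp ((2 * Real.pi * I : ℂ) • p)‖ <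
      Real.exp (2 * Real.pi * δ₂))
    (h2 : ‖WienerFamily.const ι (mode (-1)) * NormedSpace.exp (-((2 * Real.pi * I : ℂ) • p))‖ <
      Real.exp (2 * Real.pi * δ₂)) {i : ι} {z : ℂ} (hz : |z.im| ≤ δ) :
    WienerFamily.evalAt i z hz (composeFamily s g p) =
      (∑' k, s k * coeff k g * fourierExp k (z + (p i).eval z)) + s 0 * coeff 0 g := by
  obtain ⟨hp, hn⟩ := summable_posCoeff_negCoeff (δ₁ := δ₁) hs hδ
  have key : ∀ (φ : ℕ → Wiener δ₁ →L[ℂ] ℂ) (x : WienerFamily ι δ),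
      (Summable fun n => ‖φ n‖ * Real.exp (2 * Real.pi * δ₂) ^ n) →
      ‖x‖ < Real.exp (2 * Real.pi * δ₂) →
      HasSum (fun n => φ n g * (WienerFamily.evalAt i z hz x) ^ n)
        (WienerFamily.evalAt i z hz (functionalSum φ g x)) := by
    intro φ x hφ hx
    have := (hasSum_functionalSum (r := ⟨Real.exp (2 * Real.pi * δ₂), (Real.exp_pos _).le⟩)
      hφ g hx).map (WienerFamily.evalAt i z hz) (WienerFamily.continuous_evalAt hz)
    refine this.congr_fun fun n => ?_
    simp
  have hc : ∀ k : ℤ, WienerFamily.evalAt i z hz (WienerFamily.const ι (mode k)) =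
      fourierExp k z := fun k => evalHom_mode hz k
  have hpow : ∀ (w : ℂ) (n : ℕ), fourierExp 1 w ^ n = fourierExp n w := by
    intro w n
    rw [fourierExp, fourierExp, ← Complex.exp_nat_mul]; congr 1; push_cast; ring
  have hpow' : ∀ (w : ℂ) (n : ℕ), fourierExp (-1) w ^ n = fourierExp (-n) w := by
    intro w n
    rw [fourierExp, fourierExp, ← Complex.exp_nat_mul]; congr 1; push_cast; ring
  have hA := key _ _ hp h1
  have hB := key _ _ hn h2
  have e1 : WienerFamily.evalAt i z hz
      (WienerFamily.const ι (mode 1) * NormedSpace.exp ((2 * Real.pi * I : ℂ) • p)) =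
      fourierExp 1 (z + (p i).eval z) := by
    rw [map_mul, hc, WienerFamily.evalAt_exp, map_smul, WienerFamily.evalAt_eq, fourierExp_add,
      smul_eq_mul, fourierExp, fourierExp]
    simp
  have e2 : WienerFamily.evalAt i z hz
      (WienerFamily.const ι (mode (-1)) * NormedSpace.exp (-((2 * Real.pi * I : ℂ) • p))) =
      fourierExp (-1) (z + (p i).eval z) := by
    rw [map_mul, hc, WienerFamily.evalAt_exp, map_neg, map_smul, WienerFamily.evalAt_eq,
      fourierExp_add, smul_eq_mul, fourierExp, fourierExp]
    simp
  rw [e1] at hA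
  rw [e2] at hB
  simp only [hpow, hpow', posCoeff, negCoeff, smul_apply, smul_eq_mul] at hA hB
  have h := HasSum.of_nat_of_neg (f := fun k : ℤ =>
    s k * coeff k g * fourierExp k (z + (p i).eval z)) hA hB
  rw [h.tsum_eq, composeFamily, composeSum, map_add]
  simp

end Compose

/-! ### Operators on families -/

/-- The symbol of the primitive with mean zero; it vanishes at `k = 0` because `0⁻¹ = 0`. -/
def primitiveSymbol (k : ℤ) : ℂ := (2 * Real.pi * I * k)⁻¹

theorem norm_two_pi_I_mul (k : ℤ) : ‖2 * Real.pi * I * (k : ℂ)‖ = 2 * Real.pi * |(k : ℝ)| := by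
  simp [abs_of_pos Real.pi_pos]

theorem norm_primitiveSymbol_le (k : ℤ) : ‖primitiveSymbol k‖ ≤ 1 := by
  rcases eq_or_ne k 0 with rfl | hk
  · simp [primitiveSymbol]
  · rw [primitiveSymbol, norm_inv, norm_two_pi_I_mul]
    have h1 : (1 : ℝ) ≤ |(k : ℝ)| := by exact_mod_cast Int.one_le_abs hk
    refine inv_le_one_of_one_le₀ ?_
    nlinarith [Real.pi_gt_three]

/-- The symbol of the operator which inverts `u ↦ (u ∘ R_α - u)'` on functions with mean zero; it
vanishes at `k = 0` because `0⁻¹ = 0`. -/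
def cohomologicalSymbol (α : ℝ) (k : ℤ) : ℂ := (2 * Real.pi * I * k * (fourierExp k α - 1))⁻¹

/-- For `α` of bounded type, solving the cohomological equation loses one derivative, which the
integration in the operator regains. -/
theorem norm_cohomologicalSymbol_le {K : ℕ} {α : ℝ} (hα : α ∈ BoundedType K) (k : ℤ) :
    ‖cohomologicalSymbol α k‖ ≤ K + 1 := by
  rcases eq_or_ne k 0 with rfl | hk
  · simp [cohomologicalSymbol]; positivity
  · have h := one_le_mul_norm_fourierExp_sub_one hα hk
    rw [cohomologicalSymbol, norm_inv, norm_mul, norm_two_pi_I_mul]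
    set t := |(k : ℝ)| * ‖fourierExp k α - 1‖ with ht
    have h0 : (0 : ℝ) < K + 1 := by positivity
    have ht0 : 0 < t := by
      by_contra h'
      nlinarith
    rw [mul_assoc, ← ht, inv_le_comm₀ (by positivity) h0, ← one_div, div_le_iff₀ h0]
    nlinarith [Real.pi_gt_three, mul_pos ht0 h0]

theorem norm_fourierExp_ofReal (k : ℤ) (x : ℝ) : ‖fourierExp k x‖ = 1 := by
  rw [norm_fourierExp]; simp

theorem cohomologicalSymbol_mul {K : ℕ} {α : ℝ} (hα : α ∈ BoundedType K) {k : ℤ} (hk : k ≠ 0) :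
    2 * Real.pi * I * k * (fourierExp k α - 1) * cohomologicalSymbol α k = 1 := by
  have h := one_le_mul_norm_fourierExp_sub_one hα hk
  have h1 : fourierExp k α - 1 ≠ 0 := by
    intro h0
    rw [h0] at h
    simp at h
    linarith
  have h3 : (2 * Real.pi * I * k : ℂ) ≠ 0 := by simp [hk, Real.pi_ne_zero]
  exact mul_inv_cancel₀ (mul_ne_zero h3 h1)

/-- The symbol of the mean value. -/
def meanSymbol (k : ℤ) : ℂ := if k = 0 then 1 else 0

theorem norm_meanSymbol_le (k : ℤ) : ‖meanSymbol k‖ ≤ 1 := by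
  rw [meanSymbol]; split_ifs <;> simp

namespace Wiener

variable {δ : ℝ≥0}

theorem eval_multiplier_rotation (u : Wiener δ) (α : ℝ) {C : ℝ}
    (hm : ∀ k, ‖fourierExp k α‖ ≤ C) (z : ℂ) :
    (multiplier (fun k => fourierExp k α) C hm u).eval z = u.eval (z + α) := by
  simp only [eval, coeff_multiplier, fourierExp_add]
  exact tsum_congr fun k => by ring

theorem coeff_zero_one : coeff 0 (1 : Wiener δ) = 1 := by
  rw [one_def, coeff_mode_self]

theorem coeff_one_of_ne {k : ℤ} (hk : k ≠ 0) : coeff k (1 : Wiener δ) = 0 := by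
  rw [one_def, coeff_mode, if_neg hk]

theorem hasDerivAt_eval_fourier (g : Wiener δ) {z : ℂ} (hz : |z.im| < δ) :
    HasDerivAt (fun z => ∑' k, 2 * Real.pi * I * k * coeff k g * fourierExp k z)
      (∑' k, (2 * Real.pi * I * k) ^ 2 * coeff k g * fourierExp k z) z := by
  obtain ⟨s, hs, hsσ⟩ := exists_between hz
  obtain ⟨C, hC⟩ := exists_bound_deriv_coeff (norm_coeff_le_exp g) hsσ
  refine (hasDerivAt_fourierSeries hC hs).congr_deriv (tsum_congr fun k => by ring)

end Wiener

section Families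

variable (K : ℕ) (δ : ℝ≥0)

/-- A Fourier multiplier acting on families, with bounded symbols depending on the index. -/
def familyMultiplier (m : BoundedType K → ℤ → ℂ) (C : ℝ) (hm : ∀ α k, ‖m α k‖ ≤ C) (hC : 0 ≤ C) :
    WienerFamily (BoundedType K) δ →L[ℂ] WienerFamily (BoundedType K) δ :=
  lp.mapCLM ∞ (fun α => multiplier (m α) C (hm α)) hC fun α => norm_multiplier_le (hm α)

/-- The inverse of `u ↦ (u ∘ R_α - u)'` on mean-zero families. -/
def cohomologicalOp : WienerFamily (BoundedType K) δ →L[ℂ] WienerFamily (BoundedType K) δ :=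
  familyMultiplier K δ (fun α k => cohomologicalSymbol α k) (K + 1)
    (fun α k => norm_cohomologicalSymbol_le α.2 k) (by positivity)

/-- Composition of the member of index `α` with the rotation `R_α`. -/
def rotationOp : WienerFamily (BoundedType K) δ →L[ℂ] WienerFamily (BoundedType K) δ :=
  familyMultiplier K δ (fun α k => fourierExp k (α : ℝ)) 1
    (fun α k => (norm_fourierExp_ofReal k α).le) zero_le_one

/-- The mean, as a constant function. -/
def meanOp : WienerFamily (BoundedType K) δ →L[ℂ] WienerFamily (BoundedType K) δ :=
  familyMultiplier K δ (fun _ k => meanSymbol k) 1 (fun _ k => norm_meanSymbol_le k) zero_le_one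

/-- The mean-zero primitive of `u - mean u`. -/
def primitiveOp : WienerFamily (BoundedType K) δ →L[ℂ] WienerFamily (BoundedType K) δ :=
  familyMultiplier K δ (fun _ k => primitiveSymbol k) 1
    (fun _ k => norm_primitiveSymbol_le k) zero_le_one

theorem meanOp_one : meanOp K δ 1 = 1 := by
  refine lp.ext (funext fun α => ?_)
  change multiplier _ _ _ (1 : Wiener δ) = 1
  rw [one_def, multiplier, lift_mode]; simp [meanSymbol]

theorem primitiveOp_one : primitiveOp K δ 1 = 0 := by
  refine lp.ext (funext fun α => ?_)
  change multiplier _ _ _ (1 : Wiener δ) = 0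
  rw [one_def, multiplier, lift_mode]; simp [primitiveSymbol]

/-- The symbol of the second derivative. -/
def secondDerivSymbol (k : ℤ) : ℂ := (2 * Real.pi * I * k) ^ 2

theorem norm_secondDerivSymbol_le (k : ℤ) :
    ‖secondDerivSymbol k‖ ≤ (2 * Real.pi) ^ 2 * |(k : ℝ)| ^ 2 := by
  rw [secondDerivSymbol, norm_pow, norm_two_pi_I_mul, mul_pow]

theorem norm_one_symbol_le (k : ℤ) : ‖(1 : ℂ)‖ ≤ 1 * |(k : ℝ)| ^ 0 := by simp

/-- The displacement `p` of the map `id + p` with derivative `exp ψ`, when `exp ψ` has mean one. -/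
def displacement (ψ : WienerFamily (BoundedType K) δ) : WienerFamily (BoundedType K) δ :=
  primitiveOp K δ (NormedSpace.exp ψ)

variable {K δ}

/-! ### Solution of the conjugacy equation up to a constant -/

/-- A solution `ψ = log h'` of the twice differentiated conjugacy equation, up to a constant for
each index, which is small. In the equation, `cohomologicalOp` inverts `ψ ↦ (ψ ∘ R_α - ψ)'` and the
terms with `meanOp` normalize the mean of `exp ψ` to one. The bounds say that `h` is close to the
identity, that `h' ∘ R_α / h'` is close to one, and that `h` maps into the strip of half-width
`δ₂`, in the sense needed for the composition with `g`. -/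
structure IsSmallSolution {δ₁ : ℝ≥0} (δ₂ η : ℝ) (g : Wiener δ₁)
    (ψ : WienerFamily (BoundedType K) δ) : Prop where
  eq : ψ = cohomologicalOp K δ (composeFamily secondDerivSymbol g (displacement K δ ψ) *
        NormedSpace.exp ((2 : ℂ) • ψ - rotationOp K δ ψ)) + meanOp K δ ψ -
        meanOp K δ (NormedSpace.exp ψ) + 1
  norm_displacement : ‖displacement K δ ψ‖ < min η (δ₁ - δ)
  norm_exp_sub_one : ‖NormedSpace.exp ψ - 1‖ < η
  norm_quotient : ‖NormedSpace.exp (rotationOp K δ ψ - ψ) - 1‖ < 1 / 2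
  norm_pos : ‖WienerFamily.const (BoundedType K) (mode 1 : Wiener δ) *
    NormedSpace.exp ((2 * Real.pi * I : ℂ) • displacement K δ ψ)‖ < Real.exp (2 * Real.pi * δ₂)
  norm_neg : ‖WienerFamily.const (BoundedType K) (mode (-1) : Wiener δ) *
    NormedSpace.exp (-((2 * Real.pi * I : ℂ) • displacement K δ ψ))‖ < Real.exp (2 * Real.pi * δ₂)

/-- The family `g ∘ (id + p)`; the subtracted term makes up for the constant term of `g` being
counted twice in `composeFamily`. -/
def composedFamily {δ₁ : ℝ≥0} (g : Wiener δ₁) (ψ : WienerFamily (BoundedType K) δ) :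
    WienerFamily (BoundedType K) δ :=
  composeFamily (fun _ => 1) g (displacement K δ ψ) - coeff 0 g • 1

theorem norm_const_mode_lt {δ₂ : ℝ} (h : δ < δ₂) {k : ℤ} (hk : |(k : ℝ)| = 1) :
    ‖WienerFamily.const (BoundedType K) (mode k : Wiener δ)‖ < Real.exp (2 * Real.pi * δ₂) := by
  refine (WienerFamily.norm_const_le _).trans_lt ?_
  rw [norm_mode, weight, hk, mul_one]
  refine Real.exp_lt_exp.2 ?_
  have := Real.pi_pos
  gcongr

set_option maxHeartbeats 800000 in
/-- Existence, by the analytic implicit function theorem in the algebra of families. The composition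
`g ∘ (id + p)` depends analytically on `g`, and with it the correcting constant. -/
theorem exists_smallSolution (K : ℕ) {δ δ₁ : ℝ≥0} {δ₂ : ℝ} (h1 : δ < δ₂) (h2 : δ₂ < δ₁) {η : ℝ}
    (hη : 0 < η) : ∃ ρ : ℝ, 0 < ρ ∧ ∃ ψ : Wiener δ₁ → WienerFamily (BoundedType K) δ,
      ∀ g ∈ Metric.ball (0 : Wiener δ₁) ρ, IsSmallSolution δ₂ η g (ψ g) ∧
        AnalyticAt ℂ (fun g => composedFamily g (ψ g)) g := by
  have he := norm_const_mode_lt (K := K) h1 (k := 1) (by simp)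
  have he' := norm_const_mode_lt (K := K) h1 (k := -1) (by simp)
  have hsum₀ := summable_posCoeff_negCoeff (δ₁ := δ₁) norm_one_symbol_le h2
  have hsum₂ := summable_posCoeff_negCoeff (δ₁ := δ₁) norm_secondDerivSymbol_le h2
  obtain ⟨ψ, hψ, hψ0, hψeq⟩ := exists_analytic_solution
    (r := ⟨Real.exp (2 * Real.pi * δ₂), (Real.exp_pos _).le⟩)
    hsum₂.1 hsum₂.2 he he' (M := cohomologicalOp K δ) (R := rotationOp K δ)
    (meanOp_one K δ) (primitiveOp_one K δ)
  have hp : AnalyticAt ℂ (fun g => displacement K δ (ψ g)) 0 :=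
    hψ.normedSpace_exp.clm_comp (primitiveOp K δ)
  have hp0 : displacement K δ (ψ 0) = 0 := by simp [displacement, hψ0, primitiveOp_one]
  have hY : AnalyticAt ℂ (fun g => composedFamily g (ψ g)) 0 := by
    refine AnalyticAt.fun_sub ?_ ?_
    · exact AnalyticAt.composeSum (r := ⟨Real.exp (2 * Real.pi * δ₂), (Real.exp_pos _).le⟩)
        hsum₀.1 hsum₀.2 he he' analyticAt_id hp hp0
    · exact AnalyticAt.fun_smul ((coeff 0).analyticAt _) analyticAt_const
  have hψc := hψ.continuousAt
  have hpc := hp.continuousAt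
  have hqc : ContinuousAt (fun g => (2 * Real.pi * I : ℂ) • displacement K δ (ψ g)) 0 :=
    hpc.const_smul (2 * Real.pi * I : ℂ)
  have hexpc : Continuous (NormedSpace.exp : WienerFamily (BoundedType K) δ → _) :=
    continuous_iff_continuousAt.2 fun x => (NormedSpace.exp_analytic (𝕂 := ℂ) x).continuousAt
  have hsmall : ∀ {f : Wiener δ₁ → WienerFamily (BoundedType K) δ} {t : ℝ}, ContinuousAt f 0 →
      ‖f 0‖ < t → ∀ᶠ g in 𝓝 (0 : Wiener δ₁), ‖f g‖ < t :=
    fun hf ht => hf.norm.eventually_lt_const ht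
  have hev1 := hsmall (t := min η (δ₁ - δ)) hpc (by
    rw [hp0, norm_zero]; exact lt_min hη (sub_pos.2 (h1.trans h2)))
  have hev2 := hsmall (f := fun g => NormedSpace.exp (ψ g) - 1) (t := η)
    ((hexpc.continuousAt.comp hψc).sub continuousAt_const) (by simp [hψ0, hη])
  have hev3 := hsmall (f := fun g => NormedSpace.exp (rotationOp K δ (ψ g) - ψ g) - 1) (t := 1 / 2)
    ((hexpc.continuousAt.comp (((rotationOp K δ).continuous.continuousAt.comp hψc).sub hψc)).sub
      continuousAt_const) (by simp [hψ0])
  have hev4 := hsmall (f := fun g => WienerFamily.const (BoundedType K) (mode 1 : Wiener δ) *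
      NormedSpace.exp ((2 * Real.pi * I : ℂ) • displacement K δ (ψ g)))
    (t := Real.exp (2 * Real.pi * δ₂))
    (continuousAt_const.mul (hexpc.continuousAt.comp hqc)) (by simpa [hp0] using he)
  have hev5 := hsmall (f := fun g => WienerFamily.const (BoundedType K) (mode (-1) : Wiener δ) *
      NormedSpace.exp (-((2 * Real.pi * I : ℂ) • displacement K δ (ψ g))))
    (t := Real.exp (2 * Real.pi * δ₂))
    (continuousAt_const.mul (hexpc.continuousAt.comp hqc.neg))
    (by simpa [hp0] using he')
  obtain ⟨ρ, hρ, hball⟩ := Metric.eventually_nhds_iff_ball.1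
    (hψeq.and (hY.eventually_analyticAt.and (hev1.and (hev2.and (hev3.and (hev4.and hev5))))))
  refine ⟨ρ, hρ, ψ, fun g hg => ?_⟩
  obtain ⟨heq, han, hb1, hb2, hb3, hb4, hb5⟩ := hball g hg
  exact ⟨⟨heq, hb1, hb2, hb3, hb4, hb5⟩, han⟩

section Member

variable {δ₁ : ℝ≥0} {δ₂ η : ℝ} {g : Wiener δ₁} {ψ : WienerFamily (BoundedType K) δ}

theorem eval_rotationOp (α : BoundedType K) (z : ℂ) :
    (rotationOp K δ ψ α).eval z = (ψ α).eval (z + (α : ℝ)) :=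
  eval_multiplier_rotation (ψ α) α _ z

theorem eval_exp (α : BoundedType K) {z : ℂ} (hz : |z.im| ≤ δ) :
    ((NormedSpace.exp ψ : WienerFamily (BoundedType K) δ) α).eval z =
      Complex.exp ((ψ α).eval z) := by
  rw [← WienerFamily.evalAt_eq hz, WienerFamily.evalAt_exp, WienerFamily.evalAt_eq]

theorem eval_composedFamily (h : IsSmallSolution δ₂ η g ψ) (h2 : δ₂ < δ₁) (α : BoundedType K)
    {z : ℂ} (hz : |z.im| ≤ δ) :
    (composedFamily g ψ α).eval z = g.eval (z + (displacement K δ ψ α).eval z) := by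
  rw [← WienerFamily.evalAt_eq hz, composedFamily, map_sub, map_smul, map_one,
    evalAt_composeFamily norm_one_symbol_le h2 g _ h.norm_pos h.norm_neg hz]
  simp [eval]

namespace IsSmallSolution

/-- The fixed point equation in terms of Fourier coefficients. -/
theorem coeff_eq (h : IsSmallSolution δ₂ η g ψ) (α : BoundedType K) (k : ℤ) :
    coeff k (ψ α) = cohomologicalSymbol α k *
      coeff k ((composeFamily secondDerivSymbol g (displacement K δ ψ) *
        NormedSpace.exp ((2 : ℂ) • ψ - rotationOp K δ ψ) : WienerFamily (BoundedType K) δ) α) +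
      meanSymbol k * coeff k (ψ α) -
      meanSymbol k * coeff k ((NormedSpace.exp ψ : WienerFamily (BoundedType K) δ) α) +
      coeff k (1 : Wiener δ) := by
  have h1 := congrArg (fun x : WienerFamily (BoundedType K) δ => coeff k (x α)) h.eq
  refine h1.trans ?_
  rw [← coeff_multiplier (fun k => norm_cohomologicalSymbol_le α.2 k),
    ← coeff_multiplier norm_meanSymbol_le, ← coeff_multiplier norm_meanSymbol_le,
    ← map_add, ← map_sub, ← map_add]
  rfl

theorem coeff_zero_exp (h : IsSmallSolution δ₂ η g ψ) (α : BoundedType K) :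
    coeff 0 ((NormedSpace.exp ψ : WienerFamily (BoundedType K) δ) α) = 1 := by
  have := h.coeff_eq α 0
  simp only [cohomologicalSymbol, meanSymbol, coeff_zero_one, Int.cast_zero, mul_zero, zero_mul,
    inv_zero, if_true, one_mul, zero_add] at this
  linear_combination this

theorem hasDerivAt_displacement (h : IsSmallSolution δ₂ η g ψ) (α : BoundedType K) {z : ℂ}
    (hz : |z.im| < δ) :
    HasDerivAt (displacement K δ ψ α).eval (Complex.exp ((ψ α).eval z) - 1) z := by
  set E := (NormedSpace.exp ψ : WienerFamily (BoundedType K) δ) α with hE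
  have h1 : ∀ k, 2 * Real.pi * I * k * coeff k (displacement K δ ψ α) = coeff k (E - 1) := by
    intro k
    have : coeff k (displacement K δ ψ α) = primitiveSymbol k * coeff k E :=
      coeff_multiplier _ k E
    rw [this, map_sub]
    rcases eq_or_ne k 0 with rfl | hk
    · simp [hE, h.coeff_zero_exp, coeff_zero_one]
    · have h3 : (2 * Real.pi * I * k : ℂ) ≠ 0 := by simp [hk, Real.pi_ne_zero]
      rw [coeff_one_of_ne hk, sub_zero, primitiveSymbol, ← mul_assoc, mul_inv_cancel₀ h3, one_mul]
  refine (hasDerivAt_eval_of_coeff h1 hz).congr_deriv ?_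
  rw [← eval_exp α hz.le, ← hE, ← evalHom_eq_eval hz.le, ← evalHom_eq_eval hz.le, map_sub, map_one]

theorem norm_eval_displacement (h : IsSmallSolution δ₂ η g ψ) (α : BoundedType K) {z : ℂ}
    (hz : |z.im| ≤ δ) : ‖(displacement K δ ψ α).eval z‖ < min η (δ₁ - δ) := by
  rw [← WienerFamily.evalAt_eq hz]
  exact (WienerFamily.norm_evalAt_le hz _).trans_lt h.norm_displacement

/-- The fixed point equation as a differential equation for the represented functions. -/
theorem hasDerivAt_sub_rotation (h : IsSmallSolution δ₂ η g ψ) (h2 : δ₂ < δ₁) (α : BoundedType K) :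
    ∃ v₀ : ℂ, ∀ z : ℂ, |z.im| < δ →
    HasDerivAt (fun z => (ψ α).eval (z + (α : ℝ)) - (ψ α).eval z)
      ((∑' k, (2 * Real.pi * I * k) ^ 2 * coeff k g *
          fourierExp k (z + (displacement K δ ψ α).eval z)) *
        Complex.exp (2 * (ψ α).eval z - (ψ α).eval (z + (α : ℝ))) - v₀) z := by
  set V := composeFamily secondDerivSymbol g (displacement K δ ψ) *
        NormedSpace.exp ((2 : ℂ) • ψ - rotationOp K δ ψ) with hV
  refine ⟨coeff 0 (V α), fun z hz => ?_⟩
  have huk : ∀ k, k ≠ 0 → coeff k (ψ α) = cohomologicalSymbol α k * coeff k (V α) := by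
    intro k hk
    have := h.coeff_eq α k
    rw [meanSymbol, if_neg hk, coeff_one_of_ne hk] at this
    linear_combination this
  set d : Wiener δ := rotationOp K δ ψ α - ψ α with hd
  have h1 : ∀ k, 2 * Real.pi * I * k * coeff k d =
      coeff k (V α - coeff 0 (V α) • (1 : Wiener δ)) := by
    intro k
    have h3 : coeff k (rotationOp K δ ψ α) = fourierExp k (α : ℝ) * coeff k (ψ α) :=
      coeff_multiplier _ k _
    rw [hd, map_sub, map_sub, h3, map_smul]
    rcases eq_or_ne k 0 with rfl | hk
    · simp [coeff_zero_one]
    · rw [coeff_one_of_ne hk, huk k hk, smul_zero, sub_zero]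
      linear_combination coeff k (V α) * cohomologicalSymbol_mul α.2 hk
  have h3 : ∀ w : ℂ, |w.im| < δ → d.eval w = (ψ α).eval (w + (α : ℝ)) - (ψ α).eval w := by
    intro w hw
    rw [← evalHom_eq_eval hw.le, hd, map_sub, evalHom_eq_eval, evalHom_eq_eval, eval_rotationOp]
  refine ((hasDerivAt_eval_of_coeff h1 hz).congr_of_eventuallyEq ?_).congr_deriv ?_
  · filter_upwards [(isOpen_imStrip δ).mem_nhds hz] with w hw
    exact (h3 w hw).symm
  · have e1 := evalAt_composeFamily (i := α) norm_secondDerivSymbol_le h2 g _ h.norm_pos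
      h.norm_neg hz.le
    have e2 : WienerFamily.evalAt α z hz.le (rotationOp K δ ψ) = (ψ α).eval (z + (α : ℝ)) :=
      (WienerFamily.evalAt_eq _ _).trans (eval_rotationOp α z)
    rw [← evalHom_eq_eval hz.le, map_sub, map_smul, map_one, evalHom_eq_eval, smul_eq_mul,
      mul_one, ← WienerFamily.evalAt_eq hz.le, map_mul, WienerFamily.evalAt_exp,
      map_sub, map_smul, e1, e2, WienerFamily.evalAt_eq]
    simp [secondDerivSymbol]

theorem exists_const (h : IsSmallSolution δ₂ η g ψ) (h0 : 0 < δ) (h2 : δ₂ < δ₁)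
    (α : BoundedType K) :
    ∃ c, ∀ z : ℂ, |z.im| < δ → (displacement K δ ψ α).eval (z + (α : ℝ)) -
      (displacement K δ ψ α).eval z = g.eval (z + (displacement K δ ψ α).eval z) + c := by
  obtain ⟨v₀, hv₀⟩ := h.hasDerivAt_sub_rotation h2 α
  refine exists_const_conjugacy_of_logDeriv (σ₁ := δ₁) (U := (ψ α).eval)
    (G₁ := fun z => ∑' k, 2 * Real.pi * I * k * coeff k g * fourierExp k z)
    (by exact_mod_cast h0) (eval_add_one _) (eval_add_one _) (eval_add_one _)
    (fun z => by simp [fourierExp_add, fourierExp_one]) (continuousOn_eval _)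
    (fun z hz => h.hasDerivAt_displacement α hz) (fun z hz => hasDerivAt_eval g hz)
    (fun z hz => hasDerivAt_eval_fourier g hz) ?_ hv₀ ?_
  · intro z hz
    have h1 := (h.norm_eval_displacement α hz.le).trans_le (min_le_right _ _)
    have h2 := Complex.abs_im_le_norm ((displacement K δ ψ α).eval z)
    have h3 := abs_add_le z.im ((displacement K δ ψ α).eval z).im
    rw [Complex.add_im]
    linarith
  · intro z hz
    have h1 := WienerFamily.norm_evalAt_le (i := α) hz.le
      (NormedSpace.exp (rotationOp K δ ψ - ψ) - 1)
    rw [map_sub, map_one, WienerFamily.evalAt_exp, map_sub, WienerFamily.evalAt_eq,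
      WienerFamily.evalAt_eq, eval_rotationOp] at h1
    exact h1.trans h.norm_quotient.le

/-- The constant in the conjugacy equation is found by comparing means. -/
theorem conjugacy (h : IsSmallSolution δ₂ η g ψ) (h0 : 0 < δ) (h2 : δ₂ < δ₁)
    (α : BoundedType K) {z : ℂ} (hz : |z.im| < δ) : (displacement K δ ψ α).eval (z + (α : ℝ)) -
      (displacement K δ ψ α).eval z = g.eval (z + (displacement K δ ψ α).eval z) -
        coeff 0 (composedFamily g ψ α) := by
  obtain ⟨c, hc⟩ := h.exists_const h0 h2 α
  have hcval : c = -coeff 0 (composedFamily g ψ α) := by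
    set d : Wiener δ := rotationOp K δ (displacement K δ ψ) α - displacement K δ ψ α -
      composedFamily g ψ α with hd
    have h1 : ∀ x : ℝ, d.eval x = c := by
      intro x
      have hx : |(x : ℂ).im| < δ := by simpa using h0
      rw [← evalHom_eq_eval hx.le, hd, map_sub, map_sub, evalHom_eq_eval, evalHom_eq_eval,
        evalHom_eq_eval, eval_rotationOp, eval_composedFamily h h2 α hx.le]
      linear_combination hc x hx
    have h2 := integral_eval d
    have h3 : coeff 0 (rotationOp K δ (displacement K δ ψ) α) =
        fourierExp 0 (α : ℝ) * coeff 0 (displacement K δ ψ α) := coeff_multiplier _ 0 _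
    simp only [h1] at h2
    rw [hd, map_sub, map_sub, h3] at h2
    simpa using h2
  rw [hc z hz, hcval, sub_eq_add_neg]

end IsSmallSolution

end Member

end Families

/-- Every small perturbation of a rotation of bounded type becomes conjugate to the rotation after
adding a constant `c`, which depends analytically on the perturbation. The size of the domain does
not depend on `α`, since all the rotations of type bounded by `K` are treated at once. -/
theorem exists_conjugacy_family (K : ℕ) {δ δ₁ : ℝ≥0} (h0 : 0 < δ) (hδ : δ < δ₁) {η : ℝ}
    (hη : 0 < η) : ∃ ρ : ℝ, 0 < ρ ∧ ∃ c : BoundedType K → Wiener δ₁ → ℂ, ∀ α : BoundedType K,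
      AnalyticOnNhd ℂ (c α) (Metric.ball 0 ρ) ∧ ∀ g ∈ Metric.ball (0 : Wiener δ₁) ρ,
      ∃ p p' : ℂ → ℂ, (∀ z, p (z + 1) = p z) ∧ ∀ z : ℂ, |z.im| < δ →
        HasDerivAt p (p' z) z ∧ ‖p' z‖ ≤ η ∧ ‖p z‖ ≤ η ∧
        p (z + (α : ℝ)) - p z = g.eval (z + p z) + c α g := by
  obtain ⟨δ₂, hδ₂, hδ₂'⟩ := exists_between (show (δ : ℝ) < δ₁ by exact_mod_cast hδ)
  obtain ⟨ρ, hρ, ψ, hψ⟩ := exists_smallSolution K hδ₂ hδ₂' hη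
  refine ⟨ρ, hρ, fun α g => -coeff 0 (composedFamily g (ψ g) α),
    fun α => ⟨fun g hg => ?_, fun g hg => ?_⟩⟩
  · exact (AnalyticAt.fun_comp (g := ((coeff 0).comp (lp.evalCLM ℂ (fun _ => Wiener δ) ∞ α)))
      (ContinuousLinearMap.analyticAt _ _) (hψ g hg).2).fun_neg
  · have h := (hψ g hg).1
    refine ⟨(displacement K δ (ψ g) α).eval, fun z => Complex.exp ((ψ g α).eval z) - 1,
      eval_add_one _, fun z hz => ⟨h.hasDerivAt_displacement α hz, ?_,
        ((h.norm_eval_displacement α hz.le).trans_le (min_le_left _ _)).le, ?_⟩⟩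
    · have h1 := WienerFamily.norm_evalAt_le (i := α) hz.le (NormedSpace.exp (ψ g) - 1)
      rw [map_sub, map_one, WienerFamily.evalAt_exp, WienerFamily.evalAt_eq] at h1
      exact h1.trans h.norm_exp_sub_one.le
    · rw [h.conjugacy h0 hδ₂' α hz, sub_eq_add_neg]

/-! ### Functions on the strip and their periodic lifts -/

namespace Wiener

variable {δ : ℝ≥0}

theorem coeff_ext {u v : Wiener δ} (h : ∀ k, coeff k u = coeff k v) : u = v := by
  refine (hasSum_coeff u).unique ?_
  simpa only [h] using hasSum_coeff v

theorem coeff_tsum {b : ℤ → ℂ} (hb : Summable fun k => ‖b k‖ * weight δ k) (j : ℤ) :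
    coeff j (∑' k, b k • (mode k : Wiener δ)) = b j := by
  have hs : Summable fun k => b k • (mode k : Wiener δ) :=
    Summable.of_norm (by simpa [norm_smul] using hb)
  rw [(coeff j).map_tsum hs]
  simp [coeff_mode]

end Wiener

theorem Cyl.coe_add_intCast (z : ℂ) (n : ℤ) : ((z + n : ℂ) : Cyl) = (z : Cyl) := by
  rw [eq_comm, QuotientAddGroup.eq]
  exact AddSubgroup.mem_zmultiples_iff.2 ⟨n, by simp⟩

theorem Cyl.coe_eq_coe {z w : ℂ} : (z : Cyl) = (w : Cyl) ↔ ∃ n : ℤ, w = z + n := by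
  rw [QuotientAddGroup.eq, AddSubgroup.mem_zmultiples_iff]
  constructor
  · rintro ⟨n, hn⟩
    refine ⟨n, ?_⟩
    rw [zsmul_one] at hn
    rw [hn]; ring
  · rintro ⟨n, rfl⟩
    exact ⟨n, by simp⟩

theorem coe_mem_closedStrip {ε : ℝ} {z : ℂ} : (z : Cyl) ∈ closedStrip ε ↔ |z.im| ≤ ε := Iff.rfl

section StripLift

variable {ε : ℝ}

open Classical in
/-- The `ℤ`-periodic function on `ℂ` induced by a function on the closed strip of the cylinder,
extended by zero. -/
def stripLift (g : StripFun ε) (z : ℂ) : ℂ :=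
  if h : (z : Cyl) ∈ closedStrip ε then g.1 ⟨z, h⟩ else 0

theorem stripLift_of_mem (g : StripFun ε) {z : ℂ} (h : (z : Cyl) ∈ closedStrip ε) :
    stripLift g z = g.1 ⟨z, h⟩ := dif_pos h

theorem stripLift_add_one (g : StripFun ε) (z : ℂ) : stripLift g (z + 1) = stripLift g z := by
  have h1 : ((z + 1 : ℂ) : Cyl) = (z : Cyl) := by
    rw [← Cyl.coe_add_intCast z 1, Int.cast_one]
  by_cases h : (z : Cyl) ∈ closedStrip ε
  · rw [stripLift_of_mem g h, stripLift_of_mem g (h1 ▸ h)]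
    congr 1
    exact Subtype.ext h1
  · rw [stripLift, stripLift, dif_neg h, dif_neg (h1 ▸ h)]

theorem norm_stripLift_le (g : StripFun ε) (z : ℂ) : ‖stripLift g z‖ ≤ ‖g‖ := by
  unfold stripLift
  split_ifs with h
  · exact g.1.norm_coe_le_norm _
  · rw [norm_zero]; exact norm_nonneg g

theorem stripLift_add (g h : StripFun ε) (z : ℂ) :
    stripLift (g + h) z = stripLift g z + stripLift h z := by
  unfold stripLift; split_ifs <;> simp

theorem stripLift_smul (c : ℂ) (g : StripFun ε) (z : ℂ) :
    stripLift (c • g) z = c * stripLift g z := by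
  unfold stripLift; split_ifs <;> simp

theorem differentiableOn_stripLift (g : StripFun ε) :
    DifferentiableOn ℂ (stripLift g) {z : ℂ | |z.im| < ε} := by
  intro z hz
  obtain ⟨F, hF, hF'⟩ := g.2 z hz
  refine (hF.differentiableAt.congr_of_eventuallyEq ?_).differentiableWithinAt
  filter_upwards [hF', (isOpen_imStrip ε).mem_nhds hz] with w hw hw2
  have hm : (w : Cyl) ∈ closedStrip ε := openStrip_subset_closedStrip ε hw2
  rw [stripLift_of_mem g hm, hw hm]

theorem continuous_line_stripLift (hε : 0 < ε) (g : StripFun ε) :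
    Continuous fun x : ℝ => stripLift g x :=
  (differentiableOn_stripLift g).continuousOn.comp_continuous Complex.continuous_ofReal
    fun x => by simpa using hε

theorem norm_fourierInt_stripLift_le (g : StripFun ε) {s : ℝ} (h0 : 0 ≤ s) (hs : s < ε) (k : ℤ) :
    ‖fourierInt (stripLift g) k‖ ≤ ‖g‖ * Real.exp (-(2 * Real.pi * s * |(k : ℝ)|)) :=
  norm_fourierInt_le (differentiableOn_stripLift g) (stripLift_add_one g) h0 hs
    (fun z _ => norm_stripLift_le g z) k

variable {δ₁ : ℝ≥0}

theorem norm_term_stripLift_le (g : StripFun ε) {s : ℝ} (h0 : 0 ≤ s) (hs : s < ε) (k : ℤ) :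
    ‖fourierInt (stripLift g) k‖ * weight δ₁ k ≤
      ‖g‖ * Real.exp (-(2 * Real.pi * (s - δ₁)) * |(k : ℝ)|) := by
  calc _ ≤ ‖g‖ * Real.exp (-(2 * Real.pi * s * |(k : ℝ)|)) *
        Real.exp (2 * Real.pi * δ₁ * |(k : ℝ)|) :=
        mul_le_mul_of_nonneg_right (norm_fourierInt_stripLift_le g h0 hs k) (weight_pos k).le
    _ = _ := by rw [mul_assoc, ← Real.exp_add]; congr 2; ring

theorem summable_term_stripLift (hδ : δ₁ < ε) (g : StripFun ε) :
    Summable fun k => ‖fourierInt (stripLift g) k‖ * weight δ₁ k := by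
  obtain ⟨s, hs, hsε⟩ := exists_between hδ
  exact Summable.of_nonneg_of_le (fun k => mul_nonneg (norm_nonneg _) (weight_pos k).le)
    (norm_term_stripLift_le g (δ₁.2.trans hs.le) hsε)
    ((summable_int_exp (mul_pos (by positivity) (sub_pos.2 hs))).mul_left _)

/-- Restriction of analytic functions on the strip `Π_ε` to the smaller strip of half-width `δ₁`,
as a continuous linear map into the Wiener algebra. -/
def toWiener (ε : ℝ) (δ₁ : ℝ≥0) (hδ : δ₁ < ε) : StripFun ε →L[ℂ] Wiener δ₁ :=
  LinearMap.mkContinuous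
    { toFun := fun g => ∑' k, fourierInt (stripLift g) k • (mode k : Wiener δ₁)
      map_add' := fun g h => by
        have hε : 0 < ε := δ₁.2.trans_lt hδ
        refine coeff_ext fun k => ?_
        rw [map_add, coeff_tsum (summable_term_stripLift hδ _),
          coeff_tsum (summable_term_stripLift hδ _), coeff_tsum (summable_term_stripLift hδ _)]
        have hi : ∀ g : StripFun ε, IntervalIntegrable
            (fun x : ℝ => stripLift g x * fourierExp (-k) x) MeasureTheory.volume 0 1 := fun g =>
          ((continuous_line_stripLift hε g).mul ((differentiable_fourierExp _).continuous.comp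
            Complex.continuous_ofReal)).intervalIntegrable _ _
        simp only [fourierInt, stripLift_add, add_mul]
        exact intervalIntegral.integral_add (hi g) (hi h)
      map_smul' := fun c g => by
        refine coeff_ext fun k => ?_
        rw [RingHom.id_apply, map_smul, coeff_tsum (summable_term_stripLift hδ _),
          coeff_tsum (summable_term_stripLift hδ _)]
        simp only [fourierInt, stripLift_smul, mul_assoc, smul_eq_mul]
        exact intervalIntegral.integral_const_mul _ _ }
    (∑' k : ℤ, Real.exp (-(2 * Real.pi * ((δ₁ + ε) / 2 - δ₁)) * |(k : ℝ)|)) (fun g => by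
      have hs : (δ₁ : ℝ) < (δ₁ + ε) / 2 := by linarith
      have hsum := summable_int_exp (mul_pos (by positivity : 0 < 2 * Real.pi) (sub_pos.2 hs))
      have h1 := summable_term_stripLift hδ g
      have h2 : Summable fun k => ‖fourierInt (stripLift g) k • (mode k : Wiener δ₁)‖ := by
        simpa [norm_smul] using h1
      refine (norm_tsum_le_tsum_norm h2).trans ?_
      rw [mul_comm, ← tsum_mul_left]
      refine h2.tsum_le_tsum (fun k => ?_) (hsum.mul_left _)
      rw [norm_smul, norm_mode]
      exact norm_term_stripLift_le g (δ₁.2.trans hs.le) (by linarith) k)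

theorem coeff_toWiener (hδ : δ₁ < ε) (g : StripFun ε) (k : ℤ) :
    coeff k (toWiener ε δ₁ hδ g) = fourierInt (stripLift g) k :=
  coeff_tsum (summable_term_stripLift hδ _) k

theorem eval_toWiener (hδ : δ₁ < ε) (g : StripFun ε) {z : ℂ} (hz : |z.im| < ε) :
    (toWiener ε δ₁ hδ g).eval z = stripLift g z := by
  simp only [eval, coeff_toWiener]
  exact (hasSum_fourierInt (differentiableOn_stripLift g) (stripLift_add_one g) hz).tsum_eq

/-- The constant function `1`. -/
def stripOne (ε : ℝ) : StripFun ε :=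
  ⟨BoundedContinuousFunction.const _ 1, fun _ _ => ⟨fun _ => 1, analyticAt_const, by simp⟩⟩

theorem stripLift_stripOne {z : ℂ} (hz : |z.im| ≤ ε) : stripLift (stripOne ε) z = 1 := by
  rw [stripLift_of_mem _ hz]; rfl

end StripLift

section Displacement

variable {ε α : ℝ}

theorem Cyl.eq_of_coe_eq {z w : ℂ} (h : (z : Cyl) = (w : Cyl)) {d : ℝ} (hd : d ≤ 1 / 2)
    (hz : ‖z‖ < d) (hw : ‖w‖ < d) : z = w := by
  obtain ⟨n, rfl⟩ := Cyl.coe_eq_coe.1 h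
  have h1 : ‖(n : ℂ)‖ < 1 := by
    calc ‖(n : ℂ)‖ = ‖(z + n) - z‖ := by congr 1; ring
      _ ≤ ‖z + n‖ + ‖z‖ := norm_sub_le _ _
      _ < 1 := by linarith
  rw [Complex.norm_intCast] at h1
  have : n = 0 := by
    have h2 : |n| < 1 := by exact_mod_cast h1
    exact Int.abs_lt_one_iff.1 h2
  simp [this]

theorem Cyl.exists_coe_eq_of_norm_lt {q : Cyl} {d : ℝ} (h : ‖q‖ < d) :
    ∃ z : ℂ, (z : Cyl) = q ∧ ‖z‖ < d :=
  QuotientAddGroup.norm_lt_iff.1 h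

/-- The affine coordinate of the space of maps at the rotation `R_α` is onto the ball of radius
`κ ≤ 1/2`: lift the difference pointwise to the representative of norm less than `1/2`, which is
unique and therefore depends analytically on the point. -/
theorem exists_vadd_cylRotation {f : StripMap ε} {κ : ℝ} (hκ : κ ≤ 1 / 2)
    (h : dist f (cylRotation ε α) < κ) :
    ∃ g : StripFun ε, ‖g‖ < κ ∧ g +ᵥ cylRotation ε α = f := by
  obtain ⟨d, hd, hdκ⟩ := exists_between h
  have hd0 : 0 < d := dist_nonneg.trans_lt hd
  have hd2 : d ≤ 1 / 2 := hdκ.le.trans hκ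
  have hex : ∀ p : closedStrip ε, ∃ z : ℂ, (z : Cyl) = f p - cylRotation ε α p ∧ ‖z‖ < d := by
    intro p
    refine Cyl.exists_coe_eq_of_norm_lt ?_
    rw [← dist_eq_norm]
    exact (BoundedContinuousFunction.dist_coe_le_dist (f := f.1) (g := (cylRotation ε α).1)
      p).trans_lt hd
  choose G hG hGd using hex
  have hcontD : Continuous fun p => f p - cylRotation ε α p :=
    f.1.continuous.sub (cylRotation ε α).1.continuous
  have hcont : Continuous G := by
    refine continuous_iff_continuousAt.2 fun p => Metric.continuousAt_iff'.2 fun t ht => ?_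
    have h1 : 0 < min t (d - ‖G p‖) := lt_min ht (sub_pos.2 (hGd p))
    filter_upwards [Metric.continuousAt_iff'.1 hcontD.continuousAt _ h1] with q hq
    rw [dist_eq_norm] at hq
    obtain ⟨w, hw, hwd⟩ := Cyl.exists_coe_eq_of_norm_lt hq
    have h2 : G q = G p + w := by
      refine Cyl.eq_of_coe_eq ?_ hd2 (hGd q) ?_
      · rw [QuotientAddGroup.mk_add, hG, hG, hw]; abel
      · have := hwd.trans_le (min_le_right _ _)
        exact (norm_add_le _ _).trans_lt (by linarith)
    rw [h2, dist_eq_norm, add_sub_cancel_left]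
    exact hwd.trans_le (min_le_left _ _)
  let gb : closedStrip ε →ᵇ ℂ :=
    BoundedContinuousFunction.ofNormedAddCommGroup G hcont d fun p => (hGd p).le
  have hgb : gb ∈ StripFun ε := by
    intro z hz
    obtain ⟨F, hF, hF'⟩ := f.2 z hz
    have hm : (z : Cyl) ∈ closedStrip ε := openStrip_subset_closedStrip ε hz
    have h1 : ((G ⟨z, hm⟩ : ℂ) : Cyl) = ((F z - z - α : ℂ) : Cyl) := by
      rw [hG, cylRotation_apply, hF'.self_of_nhds hm, QuotientAddGroup.mk_sub,
        QuotientAddGroup.mk_sub]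
      abel
    obtain ⟨n, hn⟩ := Cyl.coe_eq_coe.1 h1
    have hA : AnalyticAt ℂ (fun w => F w - w - α - n) z :=
      ((hF.sub analyticAt_id).sub analyticAt_const).sub analyticAt_const
    refine ⟨fun w => F w - w - α - n, hA, ?_⟩
    have h2 : ‖F z - z - α - n‖ < d := by
      rw [hn, add_sub_cancel_right]; exact hGd _
    filter_upwards [hF', hA.continuousAt.norm.eventually_lt_const h2] with w hw hwd hwm
    refine Cyl.eq_of_coe_eq ?_ hd2 (hGd _) hwd
    have h3 : ((F w - w - α - n : ℂ) : Cyl) = ((F w - w - α : ℂ) : Cyl) := by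
      have := Cyl.coe_add_intCast (F w - w - α) (-n)
      rw [← this]; congr 1; push_cast; ring
    change ((G ⟨w, hwm⟩ : ℂ) : Cyl) = _
    rw [h3, hG, cylRotation_apply, hw hwm, QuotientAddGroup.mk_sub, QuotientAddGroup.mk_sub]
    abel
  refine ⟨⟨gb, hgb⟩, ?_, ?_⟩
  · exact (BoundedContinuousFunction.norm_ofNormedAddCommGroup_le hcont hd0.le
      (fun p => (hGd p).le)).trans_lt hdκ
  · refine Subtype.ext (BoundedContinuousFunction.ext fun p => ?_)
    change ((G p : ℂ) : Cyl) + cylRotation ε α p = f p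
    rw [hG]; abel

theorem dist_vadd_le (g : StripFun ε) (f : StripMap ε) : dist (g +ᵥ f) f ≤ ‖g‖ := by
  change dist (g +ᵥ f).1 f.1 ≤ _
  refine (BoundedContinuousFunction.dist_le (norm_nonneg g)).2 fun p => ?_
  change dist (((g.1 p : ℂ) : Cyl) + f p) (f p) ≤ _
  rw [dist_eq_norm, add_sub_cancel_right]
  exact QuotientAddGroup.norm_mk_le_norm.trans (g.1.norm_coe_le_norm p)

theorem add_vadd_stripMap (g h : StripFun ε) (f : StripMap ε) : (g + h) +ᵥ f = g +ᵥ (h +ᵥ f) := by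
  refine Subtype.ext (BoundedContinuousFunction.ext fun p => ?_)
  change (((g.1 p + h.1 p : ℂ)) : Cyl) + f p = ((g.1 p : ℂ) : Cyl) + (((h.1 p : ℂ) : Cyl) + f p)
  rw [QuotientAddGroup.mk_add, add_assoc]

/-- The function `z ↦ z + α + g z` is a lift of the map `R_α + g`. -/
theorem vadd_cylRotation_coe (g : StripFun ε) {z : ℂ} (hz : (z : Cyl) ∈ closedStrip ε) :
    (g +ᵥ cylRotation ε α) ⟨z, hz⟩ = ((z + α + stripLift g z : ℂ) : Cyl) := by
  rw [StripMap.vadd_apply, cylRotation_apply, stripLift_of_mem g hz, QuotientAddGroup.mk_add,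
    QuotientAddGroup.mk_add]
  abel

end Displacement

/-! ### Uniqueness of the correcting constant -/

section Uniqueness

/-- The mean of the difference between a periodic function and its translate vanishes. -/
theorem integral_translate_sub_eq_zero {u : ℝ → ℂ} (hc : Continuous u) (hp : ∀ x, u (x + 1) = u x)
    (α : ℝ) : ∫ x in (0 : ℝ)..1, (u (x + α) - u x) = 0 := by
  have hpi : Function.Periodic u 1 := hp
  have hα : Continuous fun x => u (x + α) := hc.comp (continuous_add_const α)
  have h := hpi.intervalIntegral_add_eq α 0
  rw [zero_add] at h
  rw [intervalIntegral.integral_sub (hα.intervalIntegrable _ _) (hc.intervalIntegrable _ _),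
    intervalIntegral.integral_comp_add_right, sub_eq_zero, zero_add, add_comm 1 α, h]

theorem fourierInt_translate_sub {u : ℂ → ℂ} {σ : ℝ} (hσ : 0 < σ)
    (hc : ContinuousOn u {z : ℂ | |z.im| < σ}) (hp : ∀ z, u (z + 1) = u z) (α : ℝ) (k : ℤ) :
    fourierInt (fun z => u (z + α) - u z) k = (fourierExp k α - 1) * fourierInt u k := by
  have hcr : Continuous fun x : ℝ => u x :=
    hc.comp_continuous Complex.continuous_ofReal fun x => by simpa using hσ
  have hw : Continuous fun x : ℝ => u x * fourierExp (-k) x :=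
    hcr.mul ((differentiable_fourierExp _).continuous.comp Complex.continuous_ofReal)
  have h := integral_translate_sub_eq_zero hw (fun x => by
    push_cast
    rw [hp, fourierExp_add, fourierExp_one, mul_one]) α
  have h1 : ∀ x : ℝ, (u (x + α) - u x) * fourierExp (-k) x =
      fourierExp k α * (u ((x + α : ℝ)) * fourierExp (-k) ((x + α : ℝ)) - u x * fourierExp (-k) x)
        + (fourierExp k α - 1) * (u x * fourierExp (-k) x) := by
    intro x
    have := fourierExp_neg_mul_self k α
    push_cast
    rw [fourierExp_add]
    linear_combination (-(u (x + α) * fourierExp (-k) x)) * this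
  have hwα : Continuous fun x : ℝ => u ((x + α : ℝ)) * fourierExp (-k) ((x + α : ℝ)) :=
    hw.comp (continuous_add_const α)
  rw [fourierInt, intervalIntegral.integral_congr (fun x _ => h1 x),
    intervalIntegral.integral_add, intervalIntegral.integral_const_mul, h,
    intervalIntegral.integral_const_mul, mul_zero, zero_add, fourierInt]
  · exact (continuous_const.mul (hwα.sub hw)).intervalIntegrable _ _
  · exact (continuous_const.mul hw).intervalIntegrable _ _

/-- A bound for the imaginary part on one horizontal line passes to the mean. -/
theorem im_fourierInt_zero {u : ℂ → ℂ} {σ : ℝ} (hd : DifferentiableOn ℂ u {z : ℂ | |z.im| < σ})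
    (hp : ∀ z : ℂ, u (z + 1) = u z) {y : ℝ} (hy : |y| < σ) {a b : ℝ}
    (hab : ∀ x : ℝ, |(u (x + y * I)).im + a| ≤ b) : |(fourierInt u 0).im + a| ≤ b := by
  have hc : Continuous fun x : ℝ => u (x + y * I) :=
    hd.continuousOn.comp_continuous (by fun_prop) fun x => by simpa using hy
  have him : Continuous fun x : ℝ => (u (x + y * I)).im := Complex.continuous_im.comp hc
  have h1 : (fourierInt u 0).im + a = ∫ x in (0 : ℝ)..1, ((u (x + y * I)).im + a) := by
    rw [intervalIntegral.integral_add (him.intervalIntegrable _ _)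
      intervalIntegrable_const, fourierInt_eq_shift hd hp 0 hy]
    have := Complex.imCLM.intervalIntegral_comp_comm (μ := MeasureTheory.volume) (a := 0) (b := 1)
      (hc.intervalIntegrable 0 1)
    simp at this ⊢
    exact this.symm
  rw [h1]
  have := intervalIntegral.norm_integral_le_of_norm_le_const (a := 0) (b := 1)
    (f := fun x : ℝ => (u (x + y * I)).im + a) (C := b) (fun x _ => hab x)
  simpa using this

/-- Estimate for the cohomological equation: on a narrower strip, a function is close to its mean
if its difference with its translate is small. -/
theorem norm_sub_mean_le {K : ℕ} {α : ℝ} (hα : α ∈ BoundedType K) {u : ℂ → ℂ} {σ s t B : ℝ}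
    (hd : DifferentiableOn ℂ u {z : ℂ | |z.im| < σ}) (hp : ∀ z : ℂ, u (z + 1) = u z)
    (h0 : 0 ≤ t) (hts : t < s) (hsσ : s < σ)
    (hB : ∀ z : ℂ, |z.im| < σ → ‖u (z + α) - u z‖ ≤ B) {z : ℂ} (hz : |z.im| ≤ t) :
    ‖u z - fourierInt u 0‖ ≤
      B * ((K + 1) *
        ∑' k : ℤ, |(k : ℝ)| ^ 1 * Real.exp (-(2 * Real.pi * (s - t)) * |(k : ℝ)|)) := by
  have hσ : 0 < σ := by linarith
  have hmaps : Set.MapsTo (fun z : ℂ => z + α) {z : ℂ | |z.im| < σ} {z : ℂ | |z.im| < σ} := by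
    intro z hz; simpa using hz
  have hdq : DifferentiableOn ℂ (fun z => u (z + α) - u z) {z : ℂ | |z.im| < σ} :=
    (hd.comp (by fun_prop) hmaps).sub hd
  have hpq : ∀ z : ℂ, u (z + 1 + α) - u (z + 1) = u (z + α) - u z := by
    intro z; rw [hp, add_right_comm, hp]
  have hq := norm_fourierInt_le hdq hpq (h0.trans hts.le) hsσ
    (fun z hz => hB z (hz.trans_lt hsσ))
  have hcoef : ∀ k : ℤ, k ≠ 0 → ‖fourierInt u k‖ ≤
      (K + 1) * |(k : ℝ)| * (B * Real.exp (-(2 * Real.pi * s * |(k : ℝ)|))) := by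
    intro k hk
    have h1 := one_le_mul_norm_fourierExp_sub_one hα hk
    have h2 := hq k
    rw [fourierInt_translate_sub hσ hd.continuousOn hp, norm_mul] at h2
    calc ‖fourierInt u k‖ = 1 * ‖fourierInt u k‖ := (one_mul _).symm
      _ ≤ ((K + 1) * (|(k : ℝ)| * ‖fourierExp k α - 1‖)) * ‖fourierInt u k‖ := by gcongr
      _ = (K + 1) * |(k : ℝ)| * (‖fourierExp k α - 1‖ * ‖fourierInt u k‖) := by ring
      _ ≤ _ := by gcongr
  have hs := hasSum_fourierInt hd hp ((hz.trans_lt hts).trans hsσ)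
  have hs' := hs.sub (hasSum_ite_eq (0 : ℤ) (fourierInt u 0))
  have hsum := summable_int_pow_mul_exp 1
    (mul_pos (by positivity : 0 < 2 * Real.pi) (sub_pos.2 hts))
  rw [← tsum_mul_left, ← tsum_mul_left]
  refine hs'.norm_le_of_bounded ((hsum.mul_left _).mul_left _).hasSum fun k => ?_
  split_ifs with hk
  · subst hk; simp
  · rw [sub_zero, norm_mul]
    calc _ ≤ (K + 1) * |(k : ℝ)| * (B * Real.exp (-(2 * Real.pi * s * |(k : ℝ)|))) *
          Real.exp (2 * Real.pi * t * |(k : ℝ)|) := by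
          gcongr
          · exact (norm_nonneg _).trans (hcoef k hk)
          · exact hcoef k hk
          · exact norm_fourierExp_le k hz
      _ = B * ((K + 1) * (|(k : ℝ)| ^ 1 * (Real.exp (-(2 * Real.pi * s * |(k : ℝ)|)) *
          Real.exp (2 * Real.pi * t * |(k : ℝ)|)))) := by ring
      _ = _ := by rw [← Real.exp_add]; congr 4; ring

/-- A map close to the identity on a strip takes every value in a narrower strip. -/
theorem exists_eq_add_of_small {σ r : ℝ} {p : ℂ → ℂ} (hr : 0 ≤ r)
    (hlip : ∀ z w : ℂ, |z.im| < σ → |w.im| < σ → ‖p z - p w‖ ≤ 1 / 10 * ‖z - w‖)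
    (hp : ∀ z : ℂ, |z.im| < σ → ‖p z‖ ≤ r / 4) {w : ℂ} (hw : |w.im| + r < σ) :
    ∃ z : ℂ, |z.im| < σ ∧ z + p z = w := by
  have hball : ∀ z ∈ Metric.closedBall w r, |z.im| < σ := by
    intro z hz
    have h1 := Complex.abs_im_le_norm (z - w)
    rw [Metric.mem_closedBall, dist_eq_norm] at hz
    have h2 := abs_add_le (z - w).im w.im
    rw [← Complex.add_im, sub_add_cancel] at h2
    linarith
  have hA : ApproximatesLinearOn (fun z => z + p z) (ContinuousLinearEquiv.refl ℂ ℂ : ℂ →L[ℂ] ℂ)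
      (Metric.closedBall w r) (1 / 10 : ℝ≥0) := by
    intro z hz z' hz'
    have := hlip z z' (hball z hz) (hball z' hz')
    simp only [ContinuousLinearEquiv.coe_refl, ContinuousLinearMap.coe_id', id]
    rw [show z + p z - (z' + p z') - (z - z') = p z - p z' by ring]
    simpa using this
  have hsurj := hA.surjOn_closedBall_of_nonlinearRightInverse
    (ContinuousLinearEquiv.refl ℂ ℂ).toNonlinearRightInverse hr le_rfl
  have hnn : (((ContinuousLinearEquiv.refl ℂ ℂ).toNonlinearRightInverse.nnnorm : ℝ))⁻¹ = 1 := by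
    change ((‖((ContinuousLinearEquiv.refl ℂ ℂ).symm : ℂ →L[ℂ] ℂ)‖₊ : ℝ))⁻¹ = 1
    simp
  have hwσ : |w.im| < σ := by linarith
  obtain ⟨z, hz, hzw⟩ := hsurj (show w ∈ Metric.closedBall (w + p w) _ by
    rw [Metric.mem_closedBall, dist_eq_norm, sub_add_cancel_left, norm_neg, hnn]
    refine (hp w hwσ).trans ?_
    push_cast
    nlinarith)
  exact ⟨z, hball z hz, hzw⟩

/-- If `h = id + p` conjugates `R_α` to `R_α + G + c`, and `H` conjugates `R_α` to `R_α + G` on some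
horizontal line, then `c = 0`: the map `k = h⁻¹ ∘ H` satisfies `|k ∘ R_α - k - α + c| ≤ |c| / 9`,
and the mean of `k ∘ R_α - k - α` over the line vanishes. -/
theorem const_eq_zero_of_conjugacies {σ r α : ℝ} {c : ℂ} {p G H : ℂ → ℂ} {y : ℝ} (hr : 0 ≤ r)
    (hp1 : ∀ z, p (z + 1) = p z)
    (hlip : ∀ z w : ℂ, |z.im| < σ → |w.im| < σ → ‖p z - p w‖ ≤ 1 / 10 * ‖z - w‖)
    (hp : ∀ z : ℂ, |z.im| < σ → ‖p z‖ ≤ r / 4)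
    (hpc : ∀ z : ℂ, |z.im| < σ → p (z + α) - p z = G (z + p z) + c)
    (hHc : Continuous fun x : ℝ => H (x + y * I))
    (hH1 : ∀ x : ℝ, H (x + 1 + y * I) = H (x + y * I) + 1)
    (hHim : ∀ x : ℝ, |(H (x + y * I)).im| + r < σ)
    (hH : ∀ x : ℝ, H (x + α + y * I) = H (x + y * I) + α + G (H (x + y * I))) : c = 0 := by
  choose k hkσ hk using fun x : ℝ => exists_eq_add_of_small hr hlip hp (hHim x)
  have hexp : ∀ z w : ℂ, |z.im| < σ → |w.im| < σ → ‖z - w‖ ≤ 2 * ‖(z + p z) - (w + p w)‖ := by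
    intro z w hz hw
    have h1 := hlip z w hz hw
    have h2 : ‖z - w‖ ≤ ‖(z + p z) - (w + p w)‖ + ‖p z - p w‖ := by
      have := norm_sub_le ((z + p z) - (w + p w)) (p z - p w)
      rwa [show (z + p z) - (w + p w) - (p z - p w) = z - w by ring] at this
    linarith [norm_nonneg (z - w)]
  have hinj : ∀ z w : ℂ, |z.im| < σ → |w.im| < σ → z + p z = w + p w → z = w := by
    intro z w hz hw h
    have := hexp z w hz hw
    rw [h, sub_self, norm_zero, mul_zero] at this
    exact sub_eq_zero.1 (norm_le_zero_iff.1 this)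
  have hkc : Continuous k := by
    refine continuous_iff_continuousAt.2 fun x => ?_
    rw [ContinuousAt, tendsto_iff_norm_sub_tendsto_zero]
    have h1 : Filter.Tendsto (fun x' : ℝ => 2 * ‖H (x' + y * I) - H (x + y * I)‖) (𝓝 x) (𝓝 0) := by
      have := (tendsto_iff_norm_sub_tendsto_zero.1 (hHc.tendsto x)).const_mul 2
      simpa using this
    refine squeeze_zero (fun _ => norm_nonneg _) (fun x' => ?_) h1
    have := hexp (k x') (k x) (hkσ x') (hkσ x)
    rwa [hk, hk] at this
  have hk1 : ∀ x, k (x + 1) = k x + 1 := by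
    intro x
    refine hinj _ _ (hkσ _) (by simpa using hkσ x) ?_
    rw [hk, hp1]
    push_cast
    rw [hH1, ← hk x]; ring
  have hdiff : ∀ x : ℝ, ‖(k (x + α) - (k x + α)) + c‖ ≤ ‖c‖ / 9 := by
    intro x
    have hm : |(k x + α).im| < σ := by simpa using hkσ x
    have h1 := hlip _ _ (hkσ (x + α)) hm
    have h2 : k (x + α) - (k x + α) + c = -(p (k (x + α)) - p (k x + α)) := by
      have e1 := hk (x + α)
      push_cast at e1
      rw [hH, ← hk x] at e1
      have e2 := hpc (k x) (hkσ x)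
      linear_combination e1 - e2
    rw [h2, norm_neg]
    have h3 : ‖k (x + α) - (k x + α)‖ ≤ ‖p (k (x + α)) - p (k x + α)‖ + ‖c‖ := by
      have : k (x + α) - (k x + α) = -(p (k (x + α)) - p (k x + α)) - c := by
        linear_combination h2
      rw [this, ← norm_neg (p (k (x + α)) - p (k x + α))]
      exact norm_sub_le _ _
    linarith
  have hu : Continuous fun x : ℝ => k x - x := hkc.sub Complex.continuous_ofReal
  have hint := integral_translate_sub_eq_zero hu (fun x => by rw [hk1]; push_cast; ring) α
  have h4 : ∫ x in (0 : ℝ)..1, ((k (x + α) - (k x + α)) + c) = c := by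
    rw [intervalIntegral.integral_add _ intervalIntegrable_const]
    · have : ∀ x : ℝ, k (x + α) - (k x + α) = (k (x + α) - ((x + α : ℝ) : ℂ)) - (k x - x) := by
        intro x; push_cast; ring
      simp only [this, hint]; simp
    · exact ((hkc.comp (continuous_add_const α)).sub
        (hkc.add continuous_const)).intervalIntegrable _ _
  have h5 := intervalIntegral.norm_integral_le_of_norm_le_const (a := 0) (b := 1)
    (f := fun x : ℝ => (k (x + α) - (k x + α)) + c) (C := ‖c‖ / 9) (fun x _ => hdiff x)
  rw [h4] at h5
  simp at h5
  exact norm_le_zero_iff.1 (by linarith [norm_nonneg c])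

end Uniqueness

section Lift

theorem norm_sub_le_of_hasDerivAt {p p' : ℂ → ℂ} {σ C : ℝ}
    (hd : ∀ z : ℂ, |z.im| < σ → HasDerivAt p (p' z) z) (hC : ∀ z : ℂ, |z.im| < σ → ‖p' z‖ ≤ C)
    {z w : ℂ} (hz : |z.im| < σ) (hw : |w.im| < σ) : ‖p z - p w‖ ≤ C * ‖z - w‖ :=
  (convex_imStrip σ).norm_image_sub_le_of_norm_hasDerivWithin_le
    (fun x hx => (hd x hx).hasDerivWithinAt) hC hw hz

/-- If `R_α + G` has some conjugacy to `R_α`, given by a lift `H`, then the constant with which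
`id + p` solves the corrected conjugacy equation vanishes. The degree `d` of `H` is a priori
unknown: comparing means on horizontal lines bounds it, and then the Diophantine property of `α`
makes it equal to one. -/
theorem const_eq_zero_of_lift {K : ℕ} {α ε κ : ℝ} (hα : α ∈ BoundedType K) (hε : 0 < ε)
    (hκ : 6 * (K + 1) * κ < 1)
    (hκ' : κ * ((K + 1) *
      ∑' k : ℤ, |(k : ℝ)| ^ 1 * Real.exp (-(2 * Real.pi * (ε / 16)) * |(k : ℝ)|)) ≤ ε / 32)
    {G H p p' : ℂ → ℂ} {c : ℂ} {d n : ℤ} (hG : ∀ z, ‖G z‖ ≤ κ)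
    (hHd : DifferentiableOn ℂ H {z : ℂ | |z.im| < ε / 2})
    (hH1 : ∀ z : ℂ, |z.im| < ε / 2 → H (z + 1) = H z + d)
    (hHim : ∀ z : ℂ, |z.im| < ε / 2 → |(H z).im| < ε)
    (hH : ∀ z : ℂ, |z.im| < ε / 2 → H (z + α) = H z + α + G (H z) + n)
    (hp1 : ∀ z, p (z + 1) = p z)
    (hpd : ∀ z : ℂ, |z.im| < ε / 2 → HasDerivAt p (p' z) z)
    (hp' : ∀ z : ℂ, |z.im| < ε / 2 → ‖p' z‖ ≤ 1 / 10)
    (hp : ∀ z : ℂ, |z.im| < ε / 2 → ‖p z‖ ≤ ε / 32)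
    (hpc : ∀ z : ℂ, |z.im| < ε / 2 → p (z + α) - p z = G (z + p z) + c) : c = 0 := by
  have hκ0 : 0 ≤ κ := (norm_nonneg _).trans (hG 0)
  have hKκ : 0 ≤ (K : ℝ) * κ := by positivity
  have hκ1 : κ < 1 := by nlinarith
  -- The periodic part of `H`, extended by zero so that it is periodic everywhere.
  set u : ℂ → ℂ := fun z => if |z.im| < ε / 2 then H z - d * z else 0 with hu
  have hu_of : ∀ z : ℂ, |z.im| < ε / 2 → u z = H z - d * z := fun z hz => if_pos hz
  have hud : DifferentiableOn ℂ u {z : ℂ | |z.im| < ε / 2} :=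
    (hHd.sub (by fun_prop : DifferentiableOn ℂ (fun z : ℂ => (d : ℂ) * z) _)).congr hu_of
  have hu1 : ∀ z : ℂ, u (z + 1) = u z := by
    intro z
    have him : (z + 1).im = z.im := by simp
    by_cases hz : |z.im| < ε / 2
    · rw [hu_of z hz, hu_of _ (by rwa [him]), hH1 z hz]; ring
    · rw [hu]; simp only [him, if_neg hz]
  have humean : ∀ y : ℝ, |y| < ε / 2 → |(fourierInt u 0).im + d * y| ≤ ε := by
    intro y hy
    refine im_fourierInt_zero hud hu1 hy fun x => ?_
    have hy' : |((x : ℂ) + y * I).im| < ε / 2 := by simpa using hy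
    have h := (hHim _ hy').le
    rw [hu_of _ hy']
    simpa using h
  have hyp : |2 * ε / 5| < ε / 2 := by rw [abs_of_pos (by positivity)]; linarith
  have hyn : |-(2 * ε / 5)| < ε / 2 := by rwa [abs_neg]
  have ha := abs_le.1 (humean _ hyp)
  have hb := abs_le.1 (humean _ hyn)
  have hdle : |(d : ℝ)| ≤ 5 / 2 := by
    rw [abs_le]; constructor <;> nlinarith
  have hd3 : |((d - 1 : ℤ) : ℝ)| ≤ 3 := by
    have h1 : |d| ≤ 2 := by
      have : ((|d| : ℤ) : ℝ) < 3 := by push_cast; linarith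
      have : |d| < 3 := by exact_mod_cast this
      lia
    rw [abs_le] at h1
    have h2 : |d - 1| ≤ 3 := by rw [abs_le]; constructor <;> lia
    exact_mod_cast h2
  have hα0 : ∀ z : ℂ, |z.im| < ε / 2 → |(z + α).im| < ε / 2 := fun z hz => by simpa using hz
  have huα : ∀ z : ℂ, |z.im| < ε / 2 →
      u (z + α) - u z = G (H z) + (((1 - d) * α + n : ℝ) : ℂ) := by
    intro z hz
    rw [hu_of z hz, hu_of _ (hα0 z hz), hH z hz]
    push_cast; ring
  have hmean : |((d - 1 : ℤ) : ℝ) * α - n| ≤ κ := by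
    have hreal : ∀ x : ℝ, |(x : ℂ).im| < ε / 2 := fun x => by simpa using hε
    have hcr : Continuous fun x : ℝ => u x :=
      hud.continuousOn.comp_continuous Complex.continuous_ofReal hreal
    have h1 := integral_translate_sub_eq_zero hcr (fun x => by push_cast; exact hu1 x) α
    have hcα : Continuous fun x : ℝ => u ((x + α : ℝ)) := hcr.comp (continuous_add_const α)
    have hdc : Continuous fun x : ℝ => u ((x + α : ℝ)) - u x := hcα.sub hcr
    have h2 : ∫ x in (0 : ℝ)..1, (u ((x + α : ℝ)) - u x - (((1 - d) * α + n : ℝ) : ℂ)) =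
        -(((1 - d) * α + n : ℝ) : ℂ) := by
      rw [intervalIntegral.integral_sub (hdc.intervalIntegrable _ _)
        intervalIntegrable_const, h1]
      simp
    have h3 := intervalIntegral.norm_integral_le_of_norm_le_const (a := 0) (b := 1)
      (f := fun x : ℝ => u ((x + α : ℝ)) - u x - (((1 - d) * α + n : ℝ) : ℂ)) (C := κ)
      (fun x _ => by
        have := huα x (hreal x)
        push_cast at this ⊢
        rw [this, add_sub_cancel_right]
        exact hG _)
    rw [h2, norm_neg, Complex.norm_real, Real.norm_eq_abs] at h3
    rw [← abs_neg]
    push_cast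
    convert h3 using 2 <;> ring_nf
  have hd1 : d = 1 := by
    by_contra hne
    have h := one_le_mul_abs_sub hα (sub_ne_zero.2 hne) n
    have h2 : |((d - 1 : ℤ) : ℝ)| * |((d - 1 : ℤ) : ℝ) * α - n| ≤ 3 * κ :=
      mul_le_mul hd3 hmean (abs_nonneg _) (by norm_num)
    have h3 : 2 * ((K : ℝ) + 1) * (|((d - 1 : ℤ) : ℝ)| * |((d - 1 : ℤ) : ℝ) * α - n|) ≤
      2 * ((K : ℝ) + 1) * (3 * κ) := by gcongr
    linarith
  subst hd1
  have hn0 : n = 0 := by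
    have : |(n : ℝ)| < 1 := by
      refine lt_of_le_of_lt ?_ hκ1
      simpa using hmean
    have : |n| < 1 := by exact_mod_cast this
    exact Int.abs_lt_one_iff.1 this
  subst hn0
  have hclose : ∀ z : ℂ, |z.im| ≤ 3 * ε / 8 → ‖u z - fourierInt u 0‖ ≤ ε / 32 := by
    intro z hz
    refine (norm_sub_mean_le hα hud hu1 (s := 7 * ε / 16) (t := 3 * ε / 8) (B := κ)
      (by positivity) (by linarith) (by linarith) (fun z hz => ?_) hz).trans ?_
    · rw [huα z hz]
      simpa using hG (H z)
    · rwa [show 7 * ε / 16 - 3 * ε / 8 = ε / 16 by ring]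
  -- A height at which the image of the horizontal line stays near the real axis. The constants fit:
  -- the mean of `H - id` has imaginary part at most `3ε/5`, and `3ε/5 - 3ε/8 = 9ε/40`.
  obtain ⟨y, hy, hym⟩ : ∃ y : ℝ, |y| ≤ 3 * ε / 8 ∧ |y + (fourierInt u 0).im| ≤ 9 * ε / 40 := by
    set m := (fourierInt u 0).im
    have hm1 : m ≤ 3 * ε / 5 := by push_cast at ha; linarith [ha.2]
    have hm2 : -(3 * ε / 5) ≤ m := by push_cast at hb; linarith [hb.1]
    refine ⟨max (-(3 * ε / 8)) (min (3 * ε / 8) (-m)), ?_, ?_⟩ <;> rw [abs_le] <;>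
      rcases le_total (3 * ε / 8) (-m) with h | h <;>
      rcases le_total (-(3 * ε / 8)) (-m) with h' | h' <;>
      simp only [min_eq_left, min_eq_right, h, max_def] <;> split_ifs <;> constructor <;> linarith
  have hyε : ∀ x : ℝ, |((x : ℂ) + y * I).im| < ε / 2 := by
    intro x
    have : |y| < ε / 2 := by linarith
    simpa using this
  refine const_eq_zero_of_conjugacies (σ := ε / 2) (r := ε / 8) (p := p) (G := G) (H := H)
    (α := α) (y := y) (by positivity) hp1
    (fun z w hz hw => norm_sub_le_of_hasDerivAt hpd hp' hz hw)
    (fun z hz => (hp z hz).trans (by linarith)) hpc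
    (hHd.continuousOn.comp_continuous (by fun_prop) hyε) (fun x => ?_) (fun x => ?_) (fun x => ?_)
  · have := hH1 _ (hyε x)
    rw [add_right_comm, this]; simp
  · have h1 := hclose (x + y * I) (by simpa using hy)
    have h2 := (Complex.abs_im_le_norm _).trans h1
    rw [hu_of _ (hyε x)] at h2
    simp at h2
    rw [abs_le] at h2 hym
    have : |(H (x + y * I)).im| ≤ 41 * ε / 160 := by
      rw [abs_le]; constructor <;> linarith [h2.1, h2.2, hym.1, hym.2]
    linarith
  · have := hH _ (hyε x)
    rw [add_right_comm, this]; simp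

end Lift

/-! ### Conjugacies of maps of the cylinder and solutions of the conjugacy equation -/

section Conjugacy

/-- A continuous integer valued function on a connected set is constant. -/
theorem exists_int_of_continuousOn {U : Set ℂ} (hU : IsPreconnected U) {z₀ : ℂ} (hz₀ : z₀ ∈ U)
    {φ : ℂ → ℂ} (hφ : ContinuousOn φ U) (hn : ∀ z ∈ U, ∃ n : ℤ, φ z = n) :
    ∃ n : ℤ, ∀ z ∈ U, φ z = n := by
  obtain ⟨n, hn₀⟩ := hn z₀ hz₀
  refine ⟨n, fun z hz => ?_⟩
  have hd : IsDiscrete (Set.range ((↑) : ℤ → ℝ)) :=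
    Int.isClosedEmbedding_coe_real.isEmbedding.isDiscrete_range
  obtain ⟨m, hm⟩ := hn z hz
  have h := hU.constant_of_mapsTo hd (Complex.continuous_re.comp_continuousOn hφ)
    (fun w hw => by obtain ⟨k, hk⟩ := hn w hw; exact ⟨k, by simp [hk]⟩) hz hz₀
  rw [Function.comp_apply, Function.comp_apply, hm, hn₀, Complex.intCast_re,
    Complex.intCast_re] at h
  rw [hm]
  exact_mod_cast congrArg ((↑) : ℝ → ℂ) h

/-- A continuous map from the strip to the cylinder has a continuous lift. -/
theorem exists_lift_strip {δ : ℝ} (hδ : 0 < δ) {f : {z : ℂ | |z.im| < δ} → Cyl}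
    (hf : Continuous f) :
    ∃ F : {z : ℂ | |z.im| < δ} → ℂ, Continuous F ∧ ∀ z, (F z : Cyl) = f z := by
  have h0 : (0 : ℂ) ∈ {z : ℂ | |z.im| < δ} := by simpa using hδ
  have := (convex_imStrip δ).contractibleSpace ⟨0, h0⟩
  have := (isOpen_imStrip δ).locallyPathConnectedSpace
  have : DiscreteTopology (AddSubgroup.zmultiples (1 : ℂ)) := inferInstance
  obtain ⟨e, he⟩ := QuotientAddGroup.mk_surjective (f ⟨0, h0⟩)
  obtain ⟨F, ⟨-, hF⟩, -⟩ := (AddCircle.isCoveringMap_coe (1 : ℂ)).existsUnique_continuousMap_lifts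
    ⟨f, hf⟩ ⟨0, h0⟩ e he
  exact ⟨F, F.continuous, fun z => congrFun hF z⟩

/-- A conjugacy has an analytic lift `H` to `ℂ`. Neither its degree `d` nor the integer `n` by
which it fails to satisfy the lifted equation is known at this stage. -/
theorem exists_lift_of_isConjToRotation {ε α δ : ℝ} (hδ : 0 < δ) {g : StripFun ε}
    (h : IsConjToRotation (g +ᵥ cylRotation ε α) α δ) :
    ∃ (H : ℂ → ℂ) (d n : ℤ), DifferentiableOn ℂ H {z : ℂ | |z.im| < δ} ∧
      (∀ z : ℂ, |z.im| < δ → H (z + 1) = H z + d) ∧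
      (∀ z : ℂ, |z.im| < δ → |(H z).im| < ε) ∧
      ∀ z : ℂ, |z.im| < δ → H (z + α) = H z + α + stripLift g (H z) + n := by
  obtain ⟨ξ, -, hξa, hξ⟩ := h
  have hcont : Continuous fun z : {z : ℂ | |z.im| < δ} => (ξ ⟨(z : ℂ), z.2⟩ : Cyl) := by
    refine continuous_iff_continuousAt.2 fun z => ?_
    obtain ⟨F, hF, hF'⟩ := hξa z z.2
    have hFz : ContinuousAt (fun w : {z : ℂ | |z.im| < δ} => F w) z :=
      ContinuousAt.comp (f := Subtype.val) hF.continuousAt continuous_subtype_val.continuousAt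
    have h1 : ContinuousAt (fun w : {z : ℂ | |z.im| < δ} => ((F w : ℂ) : Cyl)) z :=
      lipschitzWith_cyl_mk.continuous.continuousAt.comp hFz
    refine h1.congr ?_
    filter_upwards [continuous_subtype_val.continuousAt.eventually hF'] with w hw
    exact (hw w.2).symm
  obtain ⟨E, hE, hEξ⟩ := exists_lift_strip hδ hcont
  set H : ℂ → ℂ := fun z => if h : |z.im| < δ then E ⟨z, h⟩ else 0 with hH
  have hHE : ∀ z : {z : ℂ | |z.im| < δ}, H z = E z := fun z => dif_pos z.2
  have hHξ : ∀ (z : ℂ) (hz : |z.im| < δ), (H z : Cyl) = ξ ⟨(z : ℂ), hz⟩ := fun z hz => by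
    rw [hHE ⟨z, hz⟩, hEξ]
  have hHc : ContinuousOn H {z : ℂ | |z.im| < δ} := by
    rw [continuousOn_iff_continuous_domRestrict]
    exact hE.congr fun z => (hHE z).symm
  have h0 : (0 : ℂ) ∈ {z : ℂ | |z.im| < δ} := by simpa using hδ
  have hpre := (convex_imStrip δ).isPreconnected
  have hmaps : ∀ a : ℝ, Set.MapsTo (fun z : ℂ => z + a) {z : ℂ | |z.im| < δ} {z : ℂ | |z.im| < δ} :=
    fun a z hz => by simpa using hz
  have hHim : ∀ z : ℂ, |z.im| < δ → |(H z).im| < ε := by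
    intro z hz
    have := (ξ ⟨(z : ℂ), hz⟩).2
    rwa [← hHξ z hz] at this
  have hHd : DifferentiableOn ℂ H {z : ℂ | |z.im| < δ} := by
    intro z hz
    obtain ⟨F, hF, hF'⟩ := hξa z hz
    obtain ⟨r, hr, hball⟩ := Metric.eventually_nhds_iff_ball.1
      ((hF'.and hF.eventually_analyticAt).and ((isOpen_imStrip δ).mem_nhds hz))
    obtain ⟨n, hn⟩ := exists_int_of_continuousOn (convex_ball z r).isPreconnected
      (Metric.mem_ball_self hr) (φ := fun w => F w - H w)
      (ContinuousOn.sub (fun w hw => (hball w hw).1.2.continuousAt.continuousWithinAt)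
        (hHc.mono fun w hw => (hball w hw).2))
      (fun w hw => by
        have h1 : (ξ ⟨(w : Cyl), (hball w hw).2⟩ : Cyl) = (F w : Cyl) :=
          (hball w hw).1.1 (hball w hw).2
        rw [← hHξ] at h1
        obtain ⟨k, hk⟩ := Cyl.coe_eq_coe.1 h1
        exact ⟨k, by rw [hk]; ring⟩)
    refine DifferentiableAt.differentiableWithinAt ?_
    refine (hF.differentiableAt.sub_const (n : ℂ)).congr_of_eventuallyEq ?_
    filter_upwards [Metric.ball_mem_nhds z hr] with w hw
    rw [← hn w hw]; ring
  have hH1c : ContinuousOn (fun z => H (z + 1)) {z : ℂ | |z.im| < δ} :=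
    hHc.comp (by fun_prop) (by simpa using hmaps 1)
  obtain ⟨d, hd⟩ := exists_int_of_continuousOn hpre h0 (φ := fun z => H (z + 1) - H z)
    (hH1c.sub hHc) (fun z hz => by
      have hz1 : |(z + 1).im| < δ := by simpa using hmaps 1 hz
      have h1 : (H z : Cyl) = H (z + 1) := by
        rw [hHξ z hz, hHξ _ hz1]
        congr 2
        exact Subtype.ext (Cyl.coe_eq_coe.2 ⟨1, by simp⟩)
      obtain ⟨k, hk⟩ := Cyl.coe_eq_coe.1 h1
      exact ⟨k, by rw [hk]; ring⟩)
  have hHmaps : Set.MapsTo H {z : ℂ | |z.im| < δ} {z : ℂ | |z.im| < ε} := hHim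
  obtain ⟨n, hn⟩ := exists_int_of_continuousOn hpre h0
    (φ := fun z => H (z + α) - (H z + α + stripLift g (H z)))
    ((hHc.comp (by fun_prop) (hmaps α)).sub ((hHc.add continuousOn_const).add
      ((differentiableOn_stripLift g).continuousOn.comp hHc hHmaps))) (fun z hz => by
      have hzα : |(z + α).im| < δ := hmaps α hz
      have h1 : ((H z + α + stripLift g (H z) : ℂ) : Cyl) = H (z + α) := by
        rw [← vadd_cylRotation_coe g (coe_mem_closedStrip.2 (hHim z hz).le), hHξ _ hzα]
        have h2 := hξ ⟨(z : ℂ), hz⟩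
        have h3 : Set.inclusion (openStrip_subset_closedStrip ε) (ξ ⟨(z : ℂ), hz⟩) =
            ⟨(H z : Cyl), coe_mem_closedStrip.2 (hHim z hz).le⟩ := Subtype.ext (hHξ z hz).symm
        rw [h3] at h2
        rw [h2]
        rfl
      obtain ⟨k, hk⟩ := Cyl.coe_eq_coe.1 h1
      exact ⟨k, by rw [hk]; ring⟩)
  refine ⟨H, d, n, hHd, fun z hz => ?_, hHim, fun z hz => ?_⟩
  · rw [← hd z hz]; ring
  · rw [← hn z hz]; ring

/-- A small solution of the conjugacy equation is the displacement of a conjugacy. -/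
theorem isConjToRotation_of_solution {ε α δ : ℝ} {g : StripFun ε} {p p' : ℂ → ℂ} (hδε : δ ≤ ε / 2)
    (hp1 : ∀ z, p (z + 1) = p z)
    (hpd : ∀ z : ℂ, |z.im| < δ → HasDerivAt p (p' z) z)
    (hp' : ∀ z : ℂ, |z.im| < δ → ‖p' z‖ ≤ 1 / 10)
    (hp : ∀ z : ℂ, |z.im| < δ → ‖p z‖ ≤ ε / 32)
    (hpc : ∀ z : ℂ, |z.im| < δ → p (z + α) - p z = stripLift g (z + p z)) :
    IsConjToRotation (g +ᵥ cylRotation ε α) α δ := by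
  have hpZ : ∀ (z : ℂ) (n : ℤ), p (z + n) = p z := fun z n => by
    have : Function.Periodic p 1 := hp1
    simpa using this.int_mul n z
  have him : ∀ z : ℂ, |z.im| < δ → |(z + p z).im| < ε := by
    intro z hz
    have h1 := (Complex.abs_im_le_norm (p z)).trans (hp z hz)
    have h2 := abs_add_le z.im (p z).im
    rw [Complex.add_im]
    have : 0 ≤ |z.im| := abs_nonneg _
    linarith
  have hout : ∀ q : openStrip δ, |(Quotient.out (q : Cyl)).im| < δ := by
    intro q
    have h1 := q.2
    rwa [← QuotientAddGroup.out_eq' (q : Cyl)] at h1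
  let ξ : openStrip δ → openStrip ε := fun q =>
    ⟨((Quotient.out (q : Cyl) + p (Quotient.out (q : Cyl)) : ℂ) : Cyl), him _ (hout q)⟩
  have hξ : ∀ (z : ℂ) (hz : |z.im| < δ), (ξ ⟨(z : Cyl), hz⟩ : Cyl) = ((z + p z : ℂ) : Cyl) := by
    intro z hz
    obtain ⟨n, hn⟩ := Cyl.coe_eq_coe.1 (QuotientAddGroup.out_eq' (z : Cyl)).symm
    change ((_ : ℂ) : Cyl) = _
    rw [Cyl.coe_eq_coe]
    refine ⟨-n, ?_⟩
    change Quotient.out (z : Cyl) = _ at hn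
    simp only [hn, hpZ]
    push_cast
    ring
  refine ⟨ξ, ?_, ?_, ?_⟩
  · rintro ⟨a, ha⟩ ⟨b, hb⟩ hab
    obtain ⟨z, rfl⟩ := QuotientAddGroup.mk_surjective a
    obtain ⟨w, rfl⟩ := QuotientAddGroup.mk_surjective b
    have h1 := congrArg (Subtype.val) hab
    rw [hξ z ha, hξ w hb] at h1
    obtain ⟨n, hn⟩ := Cyl.coe_eq_coe.1 h1
    refine Subtype.ext (Cyl.coe_eq_coe.2 ⟨n, ?_⟩)
    have hz : |z.im| < δ := ha
    have hzn : |(z + n).im| < δ := by simpa using hz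
    have h2 := norm_sub_le_of_hasDerivAt hpd hp' hb hzn
    rw [hpZ, show p w - p z = -(w - (z + n)) by linear_combination hn, norm_neg] at h2
    exact sub_eq_zero.1 (norm_le_zero_iff.1 (by linarith [norm_nonneg (w - (z + n))]))
  · intro z hz
    refine ⟨fun w => w + p w, analyticAt_id.add ?_, ?_⟩
    · exact DifferentiableOn.analyticAt
        (fun w hw => (hpd w hw).differentiableAt.differentiableWithinAt)
        ((isOpen_imStrip δ).mem_nhds hz)
    · exact Filter.Eventually.of_forall fun w hw => hξ w hw
  · rintro ⟨a, ha⟩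
    obtain ⟨z, rfl⟩ := QuotientAddGroup.mk_surjective a
    have hz : |z.im| < δ := ha
    have hzα : |(z + α).im| < δ := by simpa using hz
    have h3 : Set.inclusion (openStrip_subset_closedStrip ε) (ξ ⟨(z : Cyl), ha⟩) =
        ⟨((z + p z : ℂ) : Cyl), coe_mem_closedStrip.2 (him z hz).le⟩ := Subtype.ext (hξ z hz)
    have h4 : rotateStrip α ⟨(z : Cyl), ha⟩ = ⟨((z + α : ℂ) : Cyl), hzα⟩ := rfl
    change (g +ᵥ cylRotation ε α) (Set.inclusion (openStrip_subset_closedStrip ε)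
      (ξ ⟨(z : Cyl), ha⟩)) = (ξ (rotateStrip α ⟨(z : Cyl), ha⟩) : Cyl)
    rw [h3, h4, hξ _ hzα, vadd_cylRotation_coe]
    congr 1
    linear_combination -hpc z hz

end Conjugacy

/-! ### Hypersurfaces given as graphs -/

section Submanifold

/-- A set which is locally the graph of an analytic function over a hyperplane is a submanifold of
codimension one. Here the hyperplane is `ker ℓ`, the direction of projection is `e`, and the
function is `σ`, which is constant along `e`. -/
theorem isAnalyticSubmanifoldAt_of_graph {E : Type*} [NormedAddCommGroup E] [NormedSpace ℂ E]
    (ℓ : E →L[ℂ] ℂ) {e : E} (he : ℓ e = 1) {σ : E → ℂ} {U W S : Set E} (hU : IsOpen U)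
    (hσ : AnalyticOnNhd ℂ σ U) (hinv : ∀ (g : E) (t : ℂ), σ (g + t • e) = σ g)
    (hUinv : ∀ g ∈ U, ∀ t : ℂ, g + t • e ∈ U) (hW : IsOpen W) (hWU : W ⊆ U)
    (hS : ∀ g ∈ W, g ∈ S ↔ ℓ g = σ g) {x : E} (hx : x ∈ W) : IsAnalyticSubmanifoldAt 1 S x := by
  have hinv' : ∀ (g : E) (t : ℂ), σ (g - t • e) = σ g := fun g t => by
    rw [sub_eq_add_neg, ← neg_smul, hinv]
  have hUinv' : ∀ g ∈ U, ∀ t : ℂ, g - t • e ∈ U := fun g hg t => by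
    rw [sub_eq_add_neg, ← neg_smul]; exact hUinv g hg _
  have hΦ : AnalyticOnNhd ℂ (fun g => g - σ g • e) U :=
    analyticOnNhd_id.sub (hσ.smul analyticOnNhd_const)
  have hΨ : AnalyticOnNhd ℂ (fun g => g + σ g • e) U :=
    analyticOnNhd_id.add (hσ.smul analyticOnNhd_const)
  let Φ : OpenPartialHomeomorph E E :=
    { toFun := fun g => g - σ g • e
      invFun := fun g => g + σ g • e
      source := W
      target := U ∩ (fun g => g + σ g • e) ⁻¹' W
      map_source' := fun g hg => ⟨hUinv' g (hWU hg) _, by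
        simpa only [Set.mem_preimage, hinv', sub_add_cancel] using hg⟩
      map_target' := fun g hg => hg.2
      left_inv' := fun g _ => by simp only [hinv', sub_add_cancel]
      right_inv' := fun g _ => by simp only [hinv, add_sub_cancel_right]
      open_source := hW
      open_target := hΨ.continuousOn.isOpen_inter_preimage hU hW
      continuousOn_toFun := hΦ.continuousOn.mono hWU
      continuousOn_invFun := hΨ.continuousOn.mono Set.inter_subset_left }
  refine ⟨LinearMap.ker (ℓ : E →ₗ[ℂ] ℂ), Φ, ℓ.isClosed_ker, ?_, hx, hΦ.mono hWU,
    hΨ.mono Set.inter_subset_left, ?_⟩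
  · have hsurj : Function.Surjective (ℓ : E →ₗ[ℂ] ℂ) := fun t => ⟨t • e, by simp [he]⟩
    rw [Nat.cast_one, Module.rank_eq_one_iff_finrank_eq_one,
      ((ℓ : E →ₗ[ℂ] ℂ).quotKerEquivOfSurjective hsurj).finrank_eq, Module.finrank_self]
  · ext v
    constructor
    · rintro ⟨g, ⟨hgS, hgW⟩, rfl⟩
      refine ⟨?_, Φ.map_source hgW⟩
      change ℓ (g - σ g • e) = 0
      rw [map_sub, map_smul, he, (hS g hgW).1 hgS, smul_eq_mul, mul_one, sub_self]
    · rintro ⟨hvV, hv⟩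
      refine ⟨Φ.symm v, ⟨(hS _ (Φ.map_target hv)).2 ?_, Φ.map_target hv⟩, Φ.right_inv hv⟩
      have hvV' : ℓ v = 0 := hvV
      change ℓ (v + σ v • e) = σ (v + σ v • e)
      rw [hinv, map_add, map_smul, he, hvV', smul_eq_mul, mul_one, zero_add]

end Submanifold

/-! ### The criterion for conjugacy to a rotation -/

section Criterion

variable {ε : ℝ} {δ₁ : ℝ≥0}

/-- The mean value of a function on the strip. -/
def stripMean (ε : ℝ) (δ₁ : ℝ≥0) (hδ : δ₁ < ε) : StripFun ε →L[ℂ] ℂ :=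
  (coeff 0 : Wiener δ₁ →L[ℂ] ℂ) ∘L toWiener ε δ₁ hδ

theorem stripMean_stripOne (hδ : δ₁ < ε) : stripMean ε δ₁ hδ (stripOne ε) = 1 := by
  have hε : 0 < ε := δ₁.2.trans_lt hδ
  change coeff 0 (toWiener ε δ₁ hδ (stripOne ε)) = 1
  rw [coeff_toWiener, fourierInt]
  have : ∀ x : ℝ, stripLift (stripOne ε) x * fourierExp (-0) x = 1 := fun x => by
    rw [stripLift_stripOne (by simpa using hε.le)]
    simp [fourierExp]
  rw [intervalIntegral.integral_congr fun x _ => this x]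
  simp

/-- The oscillating part `g - ∫ g` of a function on the strip, in the Wiener algebra. -/
def oscillatingPart (ε : ℝ) (δ₁ : ℝ≥0) (hδ : δ₁ < ε) : StripFun ε →L[ℂ] Wiener δ₁ :=
  toWiener ε δ₁ hδ ∘L
    (ContinuousLinearMap.id ℂ _ - (stripMean ε δ₁ hδ).smulRight (stripOne ε))

theorem oscillatingPart_stripOne (hδ : δ₁ < ε) : oscillatingPart ε δ₁ hδ (stripOne ε) = 0 := by
  change toWiener ε δ₁ hδ (stripOne ε - stripMean ε δ₁ hδ (stripOne ε) • stripOne ε) = 0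
  rw [stripMean_stripOne, one_smul, sub_self, map_zero]

theorem eval_oscillatingPart (hδ : δ₁ < ε) (g : StripFun ε) {z : ℂ} (hz : |z.im| < ε) :
    (oscillatingPart ε δ₁ hδ g).eval z = stripLift g z - stripMean ε δ₁ hδ g := by
  have h : g - stripMean ε δ₁ hδ g • stripOne ε = g + (-stripMean ε δ₁ hδ g) • stripOne ε :=
    (sub_eq_add_neg _ _).trans (congrArg (g + ·) (neg_smul _ _).symm)
  change (toWiener ε δ₁ hδ (g - stripMean ε δ₁ hδ g • stripOne ε)).eval z = _
  rw [eval_toWiener hδ _ hz, h, stripLift_add, stripLift_smul,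
    stripLift_stripOne hz.le]
  ring

/-- The maps near the rotation which are conjugate to it are those whose displacement `g` has mean
value equal to an analytic function `c` of its oscillating part: adding the constant `c - ∫ g` makes
them conjugate, and by uniqueness of the correcting constant no other value of the mean will do. -/
theorem exists_isConjToRotation_iff (K : ℕ) (hε : 0 < ε) (hδ : δ₁ < ε) (hδ' : ε / 2 < δ₁) :
    ∃ κ : ℝ, 0 < κ ∧ κ ≤ 1 / 2 ∧ ∃ ρ : ℝ, (∀ g : StripFun ε, ‖g‖ < κ →
        oscillatingPart ε δ₁ hδ g ∈ Metric.ball 0 ρ) ∧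
      ∀ α ∈ BoundedType K, ∃ c : Wiener δ₁ → ℂ, AnalyticOnNhd ℂ c (Metric.ball 0 ρ) ∧
        ∀ g : StripFun ε, ‖g‖ < κ → (IsConjToRotation (g +ᵥ cylRotation ε α) α (ε / 2) ↔
          stripMean ε δ₁ hδ g = c (oscillatingPart ε δ₁ hδ g)) := by
  obtain ⟨ρ, hρ, c, hc⟩ := exists_conjugacy_family K (δ := ⟨ε / 2, by positivity⟩) (δ₁ := δ₁)
    (η := min (1 / 10) (ε / 32)) (by exact_mod_cast half_pos hε) (by exact_mod_cast hδ')
    (by positivity)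
  set X : ℝ := (K + 1) *
    ∑' k : ℤ, |(k : ℝ)| ^ 1 * Real.exp (-(2 * Real.pi * (ε / 16)) * |(k : ℝ)|) with hX
  have hX0 : 0 ≤ X := mul_nonneg (by positivity) (tsum_nonneg fun k => by positivity)
  set L := oscillatingPart ε δ₁ hδ
  -- Constants below which, respectively, maps lift uniquely, the degree of a conjugacy is one, its
  -- displacement is nearly constant, and the correcting constant is defined.
  obtain ⟨κ, hκ0, hκ⟩ : ∃ κ : ℝ, 0 < κ ∧ κ ≤ 1 / 2 ∧ κ ≤ 1 / (12 * (K + 1)) ∧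
      κ ≤ ε / 32 / (X + 1) ∧ κ ≤ ρ / (‖L‖ + 1) :=
    ⟨min (min (1 / 2) (1 / (12 * (K + 1)))) (min (ε / 32 / (X + 1)) (ρ / (‖L‖ + 1))),
      by positivity, (min_le_left _ _).trans (min_le_left _ _),
      (min_le_left _ _).trans (min_le_right _ _), (min_le_right _ _).trans (min_le_left _ _),
      (min_le_right _ _).trans (min_le_right _ _)⟩
  obtain ⟨hκ1, hκ2, hκ3, hκ4⟩ := hκ
  rw [le_div_iff₀ (by positivity)] at hκ2 hκ3 hκ4
  have hball : ∀ g : StripFun ε, ‖g‖ < κ → L g ∈ Metric.ball 0 ρ := by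
    intro g hg
    rw [mem_ball_zero_iff]
    calc ‖L g‖ ≤ ‖L‖ * ‖g‖ := L.le_opNorm g
      _ ≤ ‖L‖ * κ := by gcongr
      _ < κ * (‖L‖ + 1) := by linarith
      _ ≤ ρ := hκ4
  refine ⟨κ, hκ0, hκ1, ρ, hball, fun α hα => ⟨c ⟨α, hα⟩, (hc ⟨α, hα⟩).1, fun g hg => ?_⟩⟩
  obtain ⟨p, p', hp1, hp⟩ := (hc ⟨α, hα⟩).2 (L g) (hball g hg)
  have hp32 : ∀ z : ℂ, |z.im| < ε / 2 → ‖p z‖ ≤ ε / 32 := fun z hz =>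
    (hp z hz).2.2.1.trans (min_le_right _ _)
  have hp10 : ∀ z : ℂ, |z.im| < ε / 2 → ‖p' z‖ ≤ 1 / 10 := fun z hz =>
    (hp z hz).2.1.trans (min_le_left _ _)
  have hpc : ∀ z : ℂ, |z.im| < ε / 2 → p (z + α) - p z =
      stripLift g (z + p z) + (c ⟨α, hα⟩ (L g) - stripMean ε δ₁ hδ g) := by
    intro z hz
    have him : |(z + p z).im| < ε := by
      have h1 := (Complex.abs_im_le_norm (p z)).trans (hp32 z hz)
      have h2 := abs_add_le z.im (p z).im
      rw [Complex.add_im]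
      linarith
    rw [(hp z hz).2.2.2, eval_oscillatingPart hδ g him]
    ring
  constructor
  · intro h
    obtain ⟨H, d, n, hHd, hH1, hHim, hH⟩ := exists_lift_of_isConjToRotation (half_pos hε) h
    have h0 := const_eq_zero_of_lift hα hε (κ := κ) (by linarith) (by rw [← hX]; linarith)
      (fun z => (norm_stripLift_le g z).trans hg.le) hHd hH1 hHim hH hp1
      (fun z hz => (hp z hz).1) hp10 hp32 hpc
    exact (sub_eq_zero.1 h0).symm
  · intro h
    refine isConjToRotation_of_solution le_rfl hp1 (fun z hz => (hp z hz).1) hp10 hp32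
      fun z hz => ?_
    rw [hpc z hz, h, sub_self, add_zero]

end Criterion

end

theorem theorem2 (K : ℕ) (ε : ℝ) (hε : 0 < ε) :
    ∃ κ : ℝ, 0 < κ ∧ ∀ α ∈ BoundedType K,
      cylRotation ε α ∈ conjClass ε α κ ∧
      IsEmbeddedAnalyticSubmanifold 1 (conjClass ε α κ) := by
  obtain ⟨δ₁, hδ', hδ⟩ : ∃ δ₁ : NNReal, ε / 2 < δ₁ ∧ δ₁ < ε :=
    ⟨⟨3 * ε / 4, by positivity⟩, by change ε / 2 < 3 * ε / 4; linarith,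
      by change 3 * ε / 4 < ε; linarith⟩
  obtain ⟨κ, hκ0, hκ, ρ, hball, hmain⟩ := exists_isConjToRotation_iff K hε hδ hδ'
  refine ⟨κ, hκ0, fun α hα => ⟨⟨by simpa using hκ0, ?_⟩, ?_⟩⟩
  · refine ⟨Set.inclusion (fun p (hp : |Cyl.im p| < ε / 2) => hp.trans (half_lt_self hε)),
      Set.inclusion_injective _, fun z _ => ⟨id, analyticAt_id, by simp⟩, fun p => rfl⟩
  · intro f hf
    obtain ⟨g₀, hg₀, rfl⟩ := exists_vadd_cylRotation hκ hf.1
    obtain ⟨c, hc, hiff⟩ := hmain α hα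
    set L := oscillatingPart ε δ₁ hδ
    set ℓ := stripMean ε δ₁ hδ
    have hLe : ∀ (g : StripFun ε) (t : ℂ), L (g + t • stripOne ε + g₀) = L (g + g₀) := by
      intro g t
      rw [add_right_comm, map_add L (g + g₀), map_smul, oscillatingPart_stripOne, smul_zero,
        add_zero]
    have hcont : Continuous fun g : StripFun ε => L (g + g₀) :=
      L.continuous.comp (continuous_id.add continuous_const)
    have hnorm : Continuous fun g : StripFun ε => ‖g + g₀‖ :=
      continuous_norm.comp (continuous_id.add continuous_const)
    have hσ : AnalyticOnNhd ℂ (fun g => c (L (g + g₀)) - ℓ g₀)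
        ((fun g => L (g + g₀)) ⁻¹' Metric.ball 0 ρ) := fun g hg => by
      have h1 : AnalyticAt ℂ (fun g => L (g + g₀)) g :=
        (L.analyticAt _).comp (analyticAt_id.add analyticAt_const)
      exact (AnalyticAt.comp (g := c) (f := fun g => L (g + g₀)) (hc _ hg) h1).sub analyticAt_const
    have hW : (0 : StripFun ε) ∈ {g : StripFun ε | ‖g + g₀‖ < κ} := by
      change ‖0 + g₀‖ < κ
      rwa [zero_add]
    -- In the coordinate centred at `f`, the class is the graph of `c ∘ L`, translated by `g₀`.
    refine isAnalyticSubmanifoldAt_of_graph ℓ (stripMean_stripOne hδ)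
      (Metric.isOpen_ball.preimage hcont) hσ (fun g t => by simp only [hLe])
      (fun g hg t => by simpa only [Set.mem_preimage, hLe] using hg)
      (isOpen_lt hnorm continuous_const) (fun g hg => hball _ hg) (fun g hg => ?_) hW
    change g +ᵥ (g₀ +ᵥ cylRotation ε α) ∈ conjClass ε α κ ↔ _
    rw [← add_vadd_stripMap, eq_sub_iff_add_eq, ← map_add, ← hiff _ hg]
    exact ⟨fun h => h.2, fun h => ⟨(dist_vadd_le _ _).trans_lt hg, h⟩⟩
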